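/- Let $\gamma(t,x)=\int_0^x s^{t-1}e^{-s}\,ds$ be the incomplete Gamma function, where for $\operatorname{Re}(t)>0$ and $x\in\mathbb{C}\setminus(-\infty,0]$ the integral is taken along the segment from $0$ to $x$ with the principal value of $s^{t-1}$. This integral is a holomorphic function of $(t,x)$ on $\{\operatorname{Re}(t)>0\}\times(\mathbb{C}\setminus(-\infty,0])$, and $\gamma$ is extended by analytic continuation to a multivalued meromorphic function. Then $\gamma$ is $\frac{\partial}{\partial t}$-transcendental over $\mathbb{C}(x,t)$. That is: for every branch of $\gamma$ obtained by analytic continuation of the integral, regarded as an element of the field of fractions of the ring of holomorphic functions on a nonempty connected open set $D\subseteq\mathbb{C}\times\mathbb{C}$ with the derivation $\frac{\partial}{\partial t}$, the elements $\gamma,\frac{\partial\gamma}{\partial t},\frac{\partial^2\gamma}{\partial t^2},\dots$ are algebraically independent over the subfield $\mathbb{C}(x,t)$ of rational functions of $x$ and $t$. -/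

import Mathlib

open scoped Topology

noncomputable section

/-! ### Differential algebra -/

section DifferentialAlgebra

/-- An element `y` of a field `M` with a derivation `δ` is `δ`-transcendental over a subfield `K`
when `y, δ y, δ² y, …` are algebraically independent over `K`. -/
def IsDiffTranscendental {k M : Type*} [Field k] [Field M] [Algebra k M]
    (K : IntermediateField k M) (δ : Derivation k M M) (y : M) : Prop :=
  AlgebraicIndependent K (fun n : ℕ => δ^[n] y)

variable {k A : Type*} [Field k] [CommRing A] [IsDomain A] [Algebra k A]

/-- The quotient rule, on a numerator and a denominator. -/
def quotientRule (δ : Derivation k A A) (a b : A) : FractionRing A :=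
  algebraMap A (FractionRing A) (b * δ a - a * δ b) / algebraMap A (FractionRing A) b ^ 2

theorem quotientRule_congr (δ : Derivation k A A) {a b c d : A} (hb : b ≠ 0) (hd : d ≠ 0)
    (h : a * d = c * b) : quotientRule δ a b = quotientRule δ c d := by
  have inj := IsFractionRing.injective A (FractionRing A)
  have hb' : algebraMap A (FractionRing A) b ≠ 0 := by
    simpa using (map_ne_zero_iff _ inj).2 hb
  have hd' : algebraMap A (FractionRing A) d ≠ 0 := by
    simpa using (map_ne_zero_iff _ inj).2 hd
  unfold quotientRule
  rw [div_eq_div_iff (pow_ne_zero 2 hb') (pow_ne_zero 2 hd')]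
  rw [← map_pow, ← map_pow, ← map_mul, ← map_mul]
  congr 1
  have h2 : a * δ d + d * δ a = c * δ b + b * δ c := by
    have := congrArg δ h
    simpa [Derivation.leibniz, smul_eq_mul] using this
  linear_combination (b * d) * h2 - (b * δ d + d * δ b) * h

/-- The extension of a derivation of a domain to its field of fractions, by the quotient rule. -/
def fractionDeriv (δ : Derivation k A A) (z : FractionRing A) : FractionRing A :=
  quotientRule δ (IsLocalization.sec (nonZeroDivisors A) z).1
    (IsLocalization.sec (nonZeroDivisors A) z).2

theorem fractionDeriv_div (δ : Derivation k A A) (a b : A) (hb : b ≠ 0) :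
    fractionDeriv δ (algebraMap A (FractionRing A) a / algebraMap A (FractionRing A) b) =
      quotientRule δ a b := by
  have inj := IsFractionRing.injective A (FractionRing A)
  have hb' : algebraMap A (FractionRing A) b ≠ 0 := by
    simpa using (map_ne_zero_iff _ inj).2 hb
  set z := algebraMap A (FractionRing A) a / algebraMap A (FractionRing A) b with hz
  have hs := IsLocalization.sec_spec (nonZeroDivisors A) z
  refine quotientRule_congr δ (nonZeroDivisors.ne_zero (SetLike.coe_mem _)) hb ?_
  apply inj
  rw [map_mul, map_mul, ← hs, hz]
  field_simp

theorem exists_fraction₂ (z w : FractionRing A) : ∃ a c b : A, b ≠ 0 ∧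
    z = algebraMap A (FractionRing A) a / algebraMap A (FractionRing A) b ∧
    w = algebraMap A (FractionRing A) c / algebraMap A (FractionRing A) b := by
  have inj := IsFractionRing.injective A (FractionRing A)
  obtain ⟨a, b, hb, rfl⟩ := IsFractionRing.div_surjective (A := A) z
  obtain ⟨c, d, hd, rfl⟩ := IsFractionRing.div_surjective (A := A) w
  have hb := nonZeroDivisors.ne_zero hb
  have hd := nonZeroDivisors.ne_zero hd
  have hb' := (map_ne_zero_iff _ inj).2 hb
  have hd' := (map_ne_zero_iff _ inj).2 hd
  refine ⟨a * d, c * b, b * d, mul_ne_zero hb hd, ?_, ?_⟩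
  · simp only [map_mul]; field_simp
  · simp only [map_mul]; field_simp

/-- The derivation of the field of fractions that extends a derivation of the domain. -/
def fractionDerivation (δ : Derivation k A A) :
    Derivation k (FractionRing A) (FractionRing A) :=
  Derivation.mk'
    { toFun := fractionDeriv δ
      map_add' := by
        intro z w
        have inj := IsFractionRing.injective A (FractionRing A)
        obtain ⟨a, c, b, hb, rfl, rfl⟩ := exists_fraction₂ z w
        rw [← add_div, ← map_add, fractionDeriv_div δ _ _ hb, fractionDeriv_div δ _ _ hb,
          fractionDeriv_div δ _ _ hb]
        unfold quotientRule
        rw [← add_div, ← map_add]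
        congr 2
        simp only [map_add]
        ring
      map_smul' := by
        intro r z
        obtain ⟨a, -, b, hb, rfl, -⟩ := exists_fraction₂ z z
        have h : r • (algebraMap A (FractionRing A) a / algebraMap A (FractionRing A) b) =
            algebraMap A (FractionRing A) (r • a) / algebraMap A (FractionRing A) b := by
          rw [Algebra.smul_def, Algebra.smul_def, map_mul,
            ← IsScalarTower.algebraMap_apply k A (FractionRing A), mul_div_assoc]
        rw [h, fractionDeriv_div δ _ _ hb, fractionDeriv_div δ _ _ hb]
        unfold quotientRule
        rw [RingHom.id_apply, Algebra.smul_def r (_ / _),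
          IsScalarTower.algebraMap_apply k A (FractionRing A), ← mul_div_assoc, ← map_mul]
        congr 2
        rw [Derivation.map_smul]
        simp only [Algebra.smul_def]
        ring }
    (by
      intro z w
      have inj := IsFractionRing.injective A (FractionRing A)
      obtain ⟨a, c, b, hb, rfl, rfl⟩ := exists_fraction₂ z w
      have hb' := (map_ne_zero_iff _ inj).2 hb
      simp only [LinearMap.coe_mk, AddHom.coe_mk]
      rw [div_mul_div_comm, ← map_mul, ← map_mul,
        fractionDeriv_div δ _ _ (mul_ne_zero hb hb), fractionDeriv_div δ _ _ hb,
        fractionDeriv_div δ _ _ hb]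
      unfold quotientRule
      simp only [map_mul, map_sub, Derivation.leibniz, smul_eq_mul, map_add]
      field_simp
      ring)

theorem fractionDerivation_algebraMap (δ : Derivation k A A) (a : A) :
    fractionDerivation δ (algebraMap A (FractionRing A) a) =
      algebraMap A (FractionRing A) (δ a) := by
  have h := fractionDeriv_div δ a 1 one_ne_zero
  rw [map_one, div_one] at h
  refine Eq.trans h ?_
  simp [quotientRule]

end DifferentialAlgebra

/-! ### Holomorphic functions of the two variables `(t, x)`

A point `z : ℂ × ℂ` is read as `z = (t, x)`. -/

/-- A domain: a nonempty connected open subset of `ℂ × ℂ`. -/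
structure Domain₂ where
  carrier : Set (ℂ × ℂ)
  isOpen : IsOpen carrier
  isConnected : IsConnected carrier

namespace Domain₂

variable (D : Domain₂)

/-- Extension by zero of a function on `D`. -/
def extendZero (f : D.carrier → ℂ) : ℂ × ℂ → ℂ :=
  Function.extend Subtype.val f 0

theorem extendZero_apply (f : D.carrier → ℂ) (z : D.carrier) : D.extendZero f z = f z :=
  Subtype.val_injective.extend_apply f 0 z

variable {D} in
theorem eventuallyEq_extendZero {f : D.carrier → ℂ} {F : ℂ × ℂ → ℂ}
    (h : ∀ z : D.carrier, F z = f z) {z : ℂ × ℂ} (hz : z ∈ D.carrier) :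
    F =ᶠ[𝓝 z] D.extendZero f := by
  filter_upwards [D.isOpen.mem_nhds hz] with w hw
  rw [D.extendZero_apply f ⟨w, hw⟩]
  exact h ⟨w, hw⟩

variable {D} in
theorem analyticOnNhd_extendZero {f : D.carrier → ℂ} {F : ℂ × ℂ → ℂ}
    (hF : AnalyticOnNhd ℂ F D.carrier) (h : ∀ z : D.carrier, F z = f z) :
    AnalyticOnNhd ℂ (D.extendZero f) D.carrier :=
  fun z hz => (hF z hz).congr (eventuallyEq_extendZero h hz)

/-- The `ℂ`-algebra of holomorphic functions on `D`. -/
def Holo : Subalgebra ℂ (D.carrier → ℂ) where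
  carrier := {f | AnalyticOnNhd ℂ (D.extendZero f) D.carrier}
  mul_mem' {f g} hf hg := analyticOnNhd_extendZero (hf.mul hg)
    (fun z => by simp [extendZero_apply])
  add_mem' {f g} hf hg := analyticOnNhd_extendZero (hf.add hg)
    (fun z => by simp [extendZero_apply])
  algebraMap_mem' c := analyticOnNhd_extendZero (F := fun _ => c) analyticOnNhd_const
    (fun z => by simp)

variable {D}

/-- A function that is analytic on `D`, as an element of the algebra of holomorphic functions. -/
def ofAnalytic (F : ℂ × ℂ → ℂ) (hF : AnalyticOnNhd ℂ F D.carrier) : D.Holo :=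
  ⟨fun z => F z, analyticOnNhd_extendZero hF (fun _ => rfl)⟩

variable (D) in
/-- The coordinate function `t`. -/
def coordT : D.Holo := ofAnalytic (fun z => z.1) (fun _ _ => analyticAt_fst)

variable (D) in
/-- The coordinate function `x`. -/
def coordX : D.Holo := ofAnalytic (fun z => z.2) (fun _ _ => analyticAt_snd)

instance : IsDomain D.Holo :=
  have : Nontrivial D.Holo := by
    obtain ⟨z, hz⟩ := D.isConnected.nonempty
    refine ⟨0, 1, fun h => ?_⟩
    have := congrArg (fun f : D.Holo => f.1 ⟨z, hz⟩) h
    simp at this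
  have : NoZeroDivisors D.Holo := by
    refine ⟨fun {f g} hfg => ?_⟩
    by_contra! hne
    obtain ⟨hf, hg⟩ := hne
    apply hg
    obtain ⟨z, hz⟩ : ∃ z, f.1 z ≠ 0 := by
      by_contra! h0
      exact hf (Subtype.ext (funext h0))
    have hev : ∀ᶠ w in 𝓝 (z : ℂ × ℂ), D.extendZero f.1 w ≠ 0 :=
      (f.2 z z.2).continuousAt.eventually_ne (by rwa [extendZero_apply])
    have hg0 : D.extendZero g.1 =ᶠ[𝓝 (z : ℂ × ℂ)] 0 := by
      filter_upwards [hev, D.isOpen.mem_nhds z.2] with w hw hwD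
      have h1 := congrArg (fun f : D.Holo => f.1 ⟨w, hwD⟩) hfg
      have h2 : f.1 ⟨w, hwD⟩ * g.1 ⟨w, hwD⟩ = 0 := by simpa using h1
      rw [← D.extendZero_apply f.1, ← D.extendZero_apply g.1] at h2
      simpa using (mul_eq_zero.1 h2).resolve_left hw
    have := AnalyticOnNhd.eqOn_zero_of_preconnected_of_eventuallyEq_zero g.2
      D.isConnected.isPreconnected z.2 hg0
    refine Subtype.ext (funext fun w => ?_)
    simpa [extendZero_apply] using this w.2
  NoZeroDivisors.to_isDomain _

/-- The partial derivative `∂F/∂t` of a function of `(t, x)`. -/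
def partialT (F : ℂ × ℂ → ℂ) (z : ℂ × ℂ) : ℂ :=
  deriv (fun t => F (t, z.2)) z.1

theorem hasDerivAt_slice {F : ℂ × ℂ → ℂ} {z : ℂ × ℂ} (hF : AnalyticAt ℂ F z) :
    HasDerivAt (fun t => F (t, z.2)) (fderiv ℂ F z (1, 0)) z.1 := by
  have h1 : HasFDerivAt F (fderiv ℂ F z) (z.1, z.2) := hF.differentiableAt.hasFDerivAt
  have h2 : HasDerivAt (fun t : ℂ => (t, z.2)) ((1 : ℂ), (0 : ℂ)) z.1 :=
    (hasDerivAt_id z.1).prodMk (hasDerivAt_const z.1 z.2)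
  exact h1.comp_hasDerivAt z.1 h2

theorem partialT_eq {F : ℂ × ℂ → ℂ} {z : ℂ × ℂ} (hF : AnalyticAt ℂ F z) :
    partialT F z = fderiv ℂ F z (1, 0) :=
  (hasDerivAt_slice hF).deriv

theorem analyticOnNhd_partialT {F : ℂ × ℂ → ℂ} (hF : AnalyticOnNhd ℂ F D.carrier) :
    AnalyticOnNhd ℂ (partialT F) D.carrier := by
  intro z hz
  have h : AnalyticAt ℂ (fun w => fderiv ℂ F w (1, 0)) z :=
    (ContinuousLinearMap.apply ℂ ℂ ((1 : ℂ), (0 : ℂ))).analyticAt _ |>.comp (hF z hz).fderiv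
  refine h.congr ?_
  filter_upwards [D.isOpen.mem_nhds hz] with w hw
  exact (partialT_eq (hF w hw)).symm

variable (D) in
/-- The derivation `∂/∂t` of the algebra of holomorphic functions on `D`. -/
def derivT : Derivation ℂ D.Holo D.Holo :=
  Derivation.mk'
    { toFun := fun f => ofAnalytic (partialT (D.extendZero f.1)) (analyticOnNhd_partialT f.2)
      map_add' := by
        intro f g
        refine Subtype.ext (funext fun z => ?_)
        have h : D.extendZero (f + g).1 =ᶠ[𝓝 (z : ℂ × ℂ)]
            D.extendZero f.1 + D.extendZero g.1 :=
          (eventuallyEq_extendZero (fun w => by simp [extendZero_apply]) z.2).symm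
        change partialT (D.extendZero (f + g).1) z =
          partialT (D.extendZero f.1) z + partialT (D.extendZero g.1) z
        rw [partialT_eq ((f + g).2 z z.2), partialT_eq (f.2 z z.2), partialT_eq (g.2 z z.2),
          h.fderiv_eq, fderiv_add (f.2 z z.2).differentiableAt (g.2 z z.2).differentiableAt]
        rfl
      map_smul' := by
        intro c f
        refine Subtype.ext (funext fun z => ?_)
        have h : D.extendZero (c • f).1 =ᶠ[𝓝 (z : ℂ × ℂ)] c • D.extendZero f.1 :=
          (eventuallyEq_extendZero (fun w => by simp [extendZero_apply]) z.2).symm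
        change partialT (D.extendZero (c • f).1) z = c • partialT (D.extendZero f.1) z
        rw [partialT_eq ((c • f).2 z z.2), partialT_eq (f.2 z z.2),
          h.fderiv_eq, fderiv_const_smul (f.2 z z.2).differentiableAt]
        rfl }
    (by
      intro f g
      refine Subtype.ext (funext fun z => ?_)
      have h : D.extendZero (f * g).1 =ᶠ[𝓝 (z : ℂ × ℂ)]
          D.extendZero f.1 * D.extendZero g.1 :=
        (eventuallyEq_extendZero (fun w => by simp [extendZero_apply]) z.2).symm
      change partialT (D.extendZero (f * g).1) z =
        f.1 z * partialT (D.extendZero g.1) z + g.1 z * partialT (D.extendZero f.1) z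
      rw [partialT_eq ((f * g).2 z z.2), partialT_eq (f.2 z z.2), partialT_eq (g.2 z z.2),
        h.fderiv_eq, fderiv_mul (f.2 z z.2).differentiableAt (g.2 z z.2).differentiableAt]
      simp [extendZero_apply])

theorem derivT_apply {f : D.Holo} {F : ℂ × ℂ → ℂ} (h : ∀ z : D.carrier, F z = f.1 z)
    (z : D.carrier) : (D.derivT f).1 z = deriv (fun t => F (t, z.1.2)) z.1.1 := by
  change deriv (fun t => D.extendZero f.1 (t, z.1.2)) z.1.1 = _
  refine Filter.EventuallyEq.deriv_eq ?_
  have hc : ContinuousAt (fun t : ℂ => (t, z.1.2)) z.1.1 := by fun_prop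
  exact hc.eventually (eventuallyEq_extendZero h z.2).symm

variable (D) in
/-- The field of quotients of holomorphic functions on `D`, a field of meromorphic functions. -/
abbrev Mero : Type := FractionRing D.Holo

variable (D) in
/-- The derivation `∂/∂t` of the field of meromorphic functions. -/
def meroDerivT : Derivation ℂ D.Mero D.Mero := fractionDerivation D.derivT

variable (D) in
/-- The field `ℂ(x, t)` of rational functions of `x` and `t`, as functions on `D`. -/
def rationalFunctions : IntermediateField ℂ D.Mero :=
  IntermediateField.adjoin ℂ
    {algebraMap D.Holo D.Mero D.coordX, algebraMap D.Holo D.Mero D.coordT}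

end Domain₂

/-! ### The incomplete Gamma function -/

namespace IncompleteGamma

/-- The integral `∫₀ˣ s ^ (t - 1) * exp (-s) ds` along the segment `s = u * x`, `0 ≤ u ≤ 1`, with
the principal value of the power. -/
def gammaIntegral (t x : ℂ) : ℂ :=
  ∫ u in (0 : ℝ)..1, ((u : ℂ) * x) ^ (t - 1) * Complex.exp (-((u : ℂ) * x)) * x

/-- The domain `Re t > 0`, `x ∉ (-∞, 0]`. -/
def principalDomain : Domain₂ where
  carrier := {t : ℂ | 0 < t.re} ×ˢ Complex.slitPlane
  isOpen := (isOpen_lt continuous_const Complex.continuous_re).prod Complex.isOpen_slitPlane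
  isConnected := by
    have h1 : IsConnected {t : ℂ | 0 < t.re} :=
      ⟨⟨1, by simp⟩, (convex_halfSpace_re_gt 0).isPreconnected⟩
    have h2 : IsConnected Complex.slitPlane :=
      (Complex.starConvex_one_slitPlane.isPathConnected Complex.one_mem_slitPlane).isConnected
    exact h1.prod h2

/-- The holomorphic branches (function elements) of the multivalued function `γ`: the principal branch, given by the
integral for `Re t > 0` and `x ∉ (-∞, 0]`, and whatever arises from it by repeated direct analytic
continuation, where a branch `f` on `D` is continued by a holomorphic function `g` on `E` if
`f` and `g` agree on a nonempty open set `W ⊆ D ∩ E`. -/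
inductive IsHolomorphicBranch : (D : Domain₂) → D.Holo → Prop
  | principal (g : principalDomain.Holo)
      (hg : ∀ z : principalDomain.carrier, g.1 z = gammaIntegral z.1.1 z.1.2) :
      IsHolomorphicBranch principalDomain g
  | continuation {D E : Domain₂} (f : D.Holo) (g : E.Holo) (hf : IsHolomorphicBranch D f)
      (W : Set (ℂ × ℂ)) (hW : IsOpen W) (hWne : W.Nonempty)
      (hWD : W ⊆ D.carrier) (hWE : W ⊆ E.carrier)
      (hfg : ∀ (z : ℂ × ℂ) (hz : z ∈ W), f.1 ⟨z, hWD hz⟩ = g.1 ⟨z, hWE hz⟩) :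
      IsHolomorphicBranch E g

/-- The branches of `γ` that are meromorphic on a domain `D` (which may meet the polar lines of
`γ`): the quotients `a / b` of holomorphic functions on `D` that coincide with a holomorphic
branch of `γ` on some domain `E ⊆ D`. -/
def IsBranch (D : Domain₂) (m : D.Mero) : Prop :=
  ∃ a b : D.Holo, b ≠ 0 ∧ m = algebraMap D.Holo D.Mero a / algebraMap D.Holo D.Mero b ∧
    ∃ (E : Domain₂) (f : E.Holo) (hED : E.carrier ⊆ D.carrier), IsHolomorphicBranch E f ∧
      ∀ z : E.carrier, a.1 ⟨z, hED z.2⟩ = f.1 z * b.1 ⟨z, hED z.2⟩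

theorem IsHolomorphicBranch.isBranch {D : Domain₂} {f : D.Holo}
    (hf : IsHolomorphicBranch D f) : IsBranch D (algebraMap D.Holo D.Mero f) :=
  ⟨f, 1, one_ne_zero, by simp, D, f, subset_rfl, hf, by simp⟩

end IncompleteGamma

end

/-! The proof lets `x → +∞` and reduces to Hölder's theorem on `Γ`. For real `x → +∞`, `γ(t, x) →
Γ(t)` locally uniformly on `Re t > 0`, so every `t`-derivative converges as well. A polynomial
relation between `x`, `t`, `γ`, `∂γ/∂t`, … is a polynomial in `x` of some degree `N` whose
coefficients have limits. Dividing by `x ^ N` and passing to the limit leaves a relation between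
`t`, `Γ`, `Γ'`, …, given by the leading coefficient (`isIndependent_of_tendsto`).

Hölder's theorem is proved by difference algebra
(`algebraicIndependent_iterate_of_functional_equation`). The function `u = Γ'/Γ` satisfies `u(t + 1)
= u(t) + 1/t`, so its derivatives solve additive equations. By Kolchin–Ostrowski, a dependence over
`ℂ(t)` would make a nontrivial constant combination of the derivatives of `1/t` equal to a
difference `g(t) - g(t + 1)` with `g` rational. This is impossible, since the combination has its
only pole at `0`. Then `Γ` is transcendental over the field generated by these derivatives, because
`t ^ n * a(t + 1) = a(t)` fails for degree reasons when `n > 0`. Finally the derivatives of `Γ` are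
rewritten through `Γ` and those of `u`.

Other branches follow by the identity theorem: restriction to a smaller domain is injective and
commutes with `∂/∂t`, so independence may be tested on any common subdomain. Holomorphy of the
integral comes from `γ(t, x) = x ^ t * ∑ (-x)^k / (k! (t + k))`. -/

noncomputable section

/-! ### Algebraic independence of solutions of difference equations -/

section KolchinOstrowski

open MvPolynomial

variable {ι K M : Type*} [Field K] [CommRing M] [Algebra K M]

/-- The semilinear substitution `X i ↦ X i + c i`, acting by `σ` on the coefficients. -/
def shiftHom (σ : K →+* K) (c : ι → K) : MvPolynomial ι K →+* MvPolynomial ι K :=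
  eval₂Hom (C.comp σ) (fun i => X i + C (c i))

@[simp] theorem shiftHom_C (σ : K →+* K) (c : ι → K) (a : K) :
    shiftHom σ c (C a) = C (σ a) := by
  simp [shiftHom]

@[simp] theorem shiftHom_X (σ : K →+* K) (c : ι → K) (i : ι) :
    shiftHom σ c (X i) = X i + C (c i) := by
  simp [shiftHom]

theorem aeval_shiftHom {σ : K →+* K} {τ : M →+* M}
    (hστ : ∀ a, τ (algebraMap K M a) = algebraMap K M (σ a)) {c : ι → K} {ψ : ι → M}
    (hψ : ∀ i, τ (ψ i) = ψ i + algebraMap K M (c i)) (P : MvPolynomial ι K) :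
    aeval ψ (shiftHom σ c P) = τ (aeval ψ P) := by
  induction P using MvPolynomial.induction_on with
  | C a => simp [hστ]
  | add p q hp hq => simp [hp, hq]
  | mul_X p i hp => simp [hp, hψ]

theorem shiftHom_monomial (σ : K →+* K) (c : ι → K) (β : ι →₀ ℕ) (a : K) :
    shiftHom σ c (monomial β a) = C (σ a) * ∏ i ∈ β.support, (X i + C (c i)) ^ β i := by
  simp [shiftHom, Finsupp.prod]

theorem monic_shifted_monomial (m : MonomialOrder ι) (c : ι → K) (β : ι →₀ ℕ) :
    m.Monic (∏ i ∈ β.support, (X i + C (c i)) ^ β i) :=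
  MonomialOrder.Monic.prod fun i _ => (MonomialOrder.monic_X_add_C m i (c i)).pow

theorem degree_shifted_monomial (m : MonomialOrder ι) (c : ι → K) (β : ι →₀ ℕ) :
    m.degree (∏ i ∈ β.support, (X i + C (c i)) ^ β i) = β := by
  rw [MonomialOrder.degree_prod fun i _ =>
    pow_ne_zero _ (MonomialOrder.monic_X_add_C m i (c i)).ne_zero]
  simp_rw [MonomialOrder.degree_pow, MonomialOrder.degree_X_add_C]
  conv_rhs => rw [← Finsupp.sum_single β]
  simp [Finsupp.sum]

theorem shiftHom_eq_sum (σ : K →+* K) (c : ι → K) (P : MvPolynomial ι K) :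
    shiftHom σ c P = ∑ β ∈ P.support,
      C (σ (coeff β P)) * ∏ i ∈ β.support, (X i + C (c i)) ^ β i := by
  conv_lhs => rw [P.as_sum, map_sum]
  exact Finset.sum_congr rfl fun β _ => shiftHom_monomial σ c β _

/-- Shifting the variables keeps each monomial monic of the same degree, so no smaller monomial
contributes to the top coefficient. -/
theorem coeff_shiftHom_degree (m : MonomialOrder ι) (σ : K →+* K) (c : ι → K)
    (P : MvPolynomial ι K) :
    coeff (m.degree P) (shiftHom σ c P) = σ (m.leadingCoeff P) := by
  rw [shiftHom_eq_sum, coeff_sum, Finset.sum_eq_single (m.degree P)]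
  · rw [coeff_C_mul]
    have := (monic_shifted_monomial m c (m.degree P)).coeff_degree
    rw [degree_shifted_monomial] at this
    rw [this, mul_one]
    rfl
  · intro β hβ hne
    refine (coeff_C_mul _ _ _).trans (mul_eq_zero_of_right _ (m.coeff_eq_zero_of_lt ?_))
    rw [degree_shifted_monomial]
    exact lt_of_le_of_ne (m.le_degree hβ) (by simpa using hne)
  · intro h
    rw [notMem_support_iff.1 h]
    simp

theorem degree_shiftHom_le (m : MonomialOrder ι) (σ : K →+* K) (c : ι → K)
    (P : MvPolynomial ι K) :
    m.toSyn (m.degree (shiftHom σ c P)) ≤ m.toSyn (m.degree P) := by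
  rw [shiftHom_eq_sum]
  refine m.degree_sum_le.trans (Finset.sup_le fun β hβ => ?_)
  refine le_trans ?_ (m.le_degree hβ)
  rw [← smul_eq_C_mul]
  refine m.degree_smul_le.trans ?_
  rw [degree_shifted_monomial]

theorem degree_shiftHom (m : MonomialOrder ι) (σ : K →+* K) (c : ι → K)
    (P : MvPolynomial ι K) : m.degree (shiftHom σ c P) = m.degree P := by
  by_cases hP : P = 0
  · simp [hP]
  refine m.toSyn.injective (le_antisymm (degree_shiftHom_le m σ c P) (m.le_degree ?_))
  rw [mem_support_iff, coeff_shiftHom_degree]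
  simpa using hP

theorem leadingCoeff_shiftHom (m : MonomialOrder ι) (σ : K →+* K) (c : ι → K)
    (P : MvPolynomial ι K) : m.leadingCoeff (shiftHom σ c P) = σ (m.leadingCoeff P) := by
  rw [← coeff_shiftHom_degree m σ c P, MonomialOrder.leadingCoeff, degree_shiftHom]

/-- Consequently the partial derivatives of an invariant polynomial are invariant, which permits a
descent on the total degree. -/
theorem pderiv_shiftHom (σ : K →+* K) (c : ι → K) (i : ι) (P : MvPolynomial ι K) :
    pderiv i (shiftHom σ c P) = shiftHom σ c (pderiv i P) := by
  classical
  induction P using MvPolynomial.induction_on with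
  | C a => simp
  | add p q hp hq => simp [hp, hq]
  | mul_X p j hp =>
    simp only [map_mul, Derivation.leibniz, smul_eq_mul, shiftHom_X, map_add, hp, pderiv_C, add_zero]
    by_cases h : j = i
    · subst h; simp
    · simp [pderiv_X_of_ne h]

theorem totalDegree_pderiv_lt (i : ι) {P : MvPolynomial ι K} (hP : P.totalDegree ≠ 0) :
    (pderiv i P).totalDegree < P.totalDegree := by
  rw [totalDegree, Finset.sup_lt_iff (by simpa using Nat.pos_of_ne_zero hP)]
  intro m hm
  rw [mem_support_iff, coeff_pderiv] at hm
  have h := le_totalDegree (mem_support_iff.2 (left_ne_zero_of_mul hm))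
  change Finsupp.sum _ (fun _ e => e) ≤ _ at h
  rw [Finsupp.sum_add_index' (fun _ => rfl) (fun _ _ _ => rfl), Finsupp.sum_single_index rfl] at h
  omega

theorem eq_C_of_pderiv_eq_zero [CharZero K] {P : MvPolynomial ι K} (h : ∀ i, pderiv i P = 0) :
    P = C (coeff 0 P) := by
  classical
  ext m
  rw [coeff_C]
  split_ifs with hm
  · rw [hm]
  obtain ⟨i, hi⟩ : ∃ i, m i ≠ 0 := by
    by_contra! h0
    exact hm (Finsupp.ext h0).symm
  have hle : Finsupp.single i 1 ≤ m := by
    rw [Finsupp.single_le_iff]; omega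
  have h1 := coeff_pderiv (i := i) P (m - Finsupp.single i 1)
  rw [h i, coeff_zero, tsub_add_cancel_of_le hle] at h1
  exact (mul_eq_zero.1 h1.symm).resolve_right (Nat.cast_add_one_ne_zero _)

/-- An invariant nonconstant polynomial yields a telescoping relation. -/
theorem exists_telescoper_of_shiftHom_eq [CharZero K] {σ : K →+* K} {c : ι → K}
    {P : MvPolynomial ι K} (hP : P.totalDegree ≠ 0) (hσ : shiftHom σ c P = P) :
    ∃ (s : Finset ι) (l : ι → K) (g : K), (∃ i ∈ s, l i ≠ 0) ∧ (∀ i, σ (l i) = l i) ∧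
      σ g + ∑ i ∈ s, l i * c i = g := by
  classical
  -- For `Q` of least degree among the nonconstant invariants, all partial derivatives are
  -- constants. Hence `Q` is affine, and its invariance, read on the constant terms, is the
  -- telescoping relation.
  obtain ⟨Q, ⟨hQ0, hQσ⟩, hmin⟩ := WellFounded.has_min
    (measure (fun Q : MvPolynomial ι K => Q.totalDegree)).wf
    {Q | Q.totalDegree ≠ 0 ∧ shiftHom σ c Q = Q} ⟨P, hP, hσ⟩
  have hd : ∀ i, (pderiv i Q).totalDegree = 0 := by
    intro i
    by_contra h
    exact hmin (pderiv i Q) ⟨h, by rw [← pderiv_shiftHom, hQσ]⟩ (totalDegree_pderiv_lt i hQ0)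
  obtain ⟨l, hl⟩ : ∃ l : ι → K, ∀ i, pderiv i Q = C (l i) :=
    ⟨_, fun i => totalDegree_eq_zero_iff_eq_C.1 (hd i)⟩
  have hlσ : ∀ i, σ (l i) = l i := by
    intro i
    have h1 := pderiv_shiftHom σ c i Q
    rw [hQσ, hl i, shiftHom_C] at h1
    exact (C_injective ι K h1).symm
  have hsupp : ∀ i, i ∉ Q.vars → l i = 0 := by
    intro i hi
    have h1 := pderiv_eq_zero_of_notMem_vars hi
    rw [hl i] at h1
    exact (C_eq_zero).1 h1
  have hR : ∀ j, pderiv j (Q - ∑ i ∈ Q.vars, C (l i) * X i) = 0 := by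
    intro j
    rw [map_sub, map_sum, hl j]
    simp only [pderiv_C_mul, pderiv_X, Pi.single_apply]
    by_cases hj : j ∈ Q.vars
    · simp [hj]
    · simp [hj, hsupp j hj]
  have hRC := eq_C_of_pderiv_eq_zero hR
  set g := coeff 0 (Q - ∑ i ∈ Q.vars, C (l i) * X i)
  have hQ : Q = C g + ∑ i ∈ Q.vars, C (l i) * X i := by
    rw [← hRC]; ring
  refine ⟨Q.vars, l, g, ?_, hlσ, ?_⟩
  · by_contra! h0
    apply hQ0
    rw [Finset.sum_eq_zero (fun i hi => by rw [h0 i hi, C_0, zero_mul]), add_zero] at hQ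
    rw [hQ, totalDegree_C]
  · have h1 := hQσ
    generalize Q.vars = s at hQ
    rw [hQ] at h1
    simp only [map_add, map_sum, map_mul, shiftHom_C, shiftHom_X, hlσ, mul_add,
      Finset.sum_add_distrib] at h1
    apply C_injective ι K
    simp only [map_add, map_sum, map_mul]
    linear_combination h1

/-- **Kolchin–Ostrowski**: solutions of `τ ψ = ψ + c` are algebraically independent over `K`
unless some linear combination of the `c i` with invariant coefficients telescopes in `K`. -/
theorem exists_telescoper_of_not_algebraicIndependent [CharZero K] [Nontrivial M]
    (m : MonomialOrder ι) {σ : K →+* K} {τ : M →+* M}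
    (hστ : ∀ a, τ (algebraMap K M a) = algebraMap K M (σ a)) {c : ι → K} {ψ : ι → M}
    (hψ : ∀ i, τ (ψ i) = ψ i + algebraMap K M (c i)) (hdep : ¬ AlgebraicIndependent K ψ) :
    ∃ (s : Finset ι) (l : ι → K) (g : K), (∃ i ∈ s, l i ≠ 0) ∧ (∀ i, σ (l i) = l i) ∧
      σ g + ∑ i ∈ s, l i * c i = g := by
  rw [algebraicIndependent_iff] at hdep
  push Not at hdep
  obtain ⟨P₀, hP₀, hP₀'⟩ := hdep
  obtain ⟨P, ⟨hP, hP0⟩, hmin⟩ := WellFounded.has_min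
    (InvImage.wf (fun P : MvPolynomial ι K => m.toSyn (m.degree P)) (wellFounded_lt))
    {P | aeval ψ P = 0 ∧ P ≠ 0} ⟨P₀, hP₀, hP₀'⟩
  have ha : m.leadingCoeff P ≠ 0 := by simpa using hP0
  -- The difference of the two sides is again a relation and its leading terms cancel, so minimality
  -- of `P` makes it zero. Thus `P` divided by its leading coefficient is invariant.
  have hPσ : C (σ (m.leadingCoeff P)) * P = C (m.leadingCoeff P) * shiftHom σ c P := by
    by_contra hne
    have hne' := sub_ne_zero.2 hne
    refine hmin _ ⟨?_, hne'⟩ ?_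
    · simp [aeval_shiftHom hστ hψ, hP]
    have hle : m.toSyn (m.degree (C (σ (m.leadingCoeff P)) * P -
        C (m.leadingCoeff P) * shiftHom σ c P)) ≤ m.toSyn (m.degree P) := by
      refine m.degree_sub_le.trans (sup_le ?_ ?_)
      · rw [← smul_eq_C_mul]; exact m.degree_smul_le
      · rw [← smul_eq_C_mul]; exact m.degree_smul_le.trans (degree_shiftHom_le m σ c P)
    refine lt_of_le_of_ne hle fun heq => ?_
    have hmem := m.degree_mem_support hne'
    rw [m.toSyn.injective heq, mem_support_iff, coeff_sub, coeff_C_mul, coeff_C_mul,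
      coeff_shiftHom_degree] at hmem
    apply hmem
    rw [MonomialOrder.leadingCoeff]
    ring
  set a := m.leadingCoeff P
  have hσa : σ a ≠ 0 := by simpa using ha
  refine exists_telescoper_of_shiftHom_eq (P := C a⁻¹ * P) (fun h => ?_) ?_
  · rw [totalDegree_eq_zero_iff_eq_C] at h
    have h1 : P = C (a * coeff 0 (C a⁻¹ * P)) := by
      rw [C_mul, ← h, ← mul_assoc, ← C_mul, mul_inv_cancel₀ ha, C_1, one_mul]
    rw [h1, aeval_C, map_eq_zero_iff _ (algebraMap K M).injective] at hP
    rw [hP, C_0] at h1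
    exact hP0 h1
  · rw [map_mul, shiftHom_C]
    have h2 : C (a * σ a) * (C (σ a⁻¹) * shiftHom σ c P) = C (a * σ a) * (C a⁻¹ * P) := by
      rw [← mul_assoc, ← mul_assoc, ← C_mul, ← C_mul, map_inv₀, mul_assoc, mul_inv_cancel₀ hσa,
        mul_one, mul_right_comm, mul_inv_cancel₀ ha, one_mul, hPσ]
    exact mul_left_cancel₀ (by simpa using ha) h2

theorem eval₂_optionEquivLeft {R S : Type*} [CommRing R] [CommRing S] [Algebra R S]
    (f : Option ι → S) (p : MvPolynomial (Option ι) R) :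
    (optionEquivLeft R ι p).eval₂ (aeval fun i => f (some i) : MvPolynomial ι R →ₐ[R] S).toRingHom
      (f none) = aeval f p := by
  induction p using MvPolynomial.induction_on with
  | C a => simp
  | add p q hp hq => simp_all
  | mul_X p i hp => cases i <;> simp_all

/-- A solution `z ≠ 0` of `τ z = t z` is transcendental over the algebra generated by
algebraically independent solutions of `τ ψ = ψ + c`, when no power of `t` is of the form
`a / σ a`. -/
theorem algebraicIndependent_option_of_multiplicative [IsDomain M]
    (m : MonomialOrder ι) {σ : K →+* K} {τ : M →+* M}
    (hστ : ∀ a, τ (algebraMap K M a) = algebraMap K M (σ a)) {c : ι → K} {ψ : ι → M}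
    (hψ : ∀ i, τ (ψ i) = ψ i + algebraMap K M (c i)) (hind : AlgebraicIndependent K ψ)
    {t : K} (ht : t ≠ 0) {z : M} (hz : z ≠ 0) (hτz : τ z = algebraMap K M t * z)
    (hK : ∀ (a : K) (n : ℕ), a ≠ 0 → t ^ n * σ a = a → n = 0) :
    AlgebraicIndependent K (fun o : Option ι => o.elim z ψ) := by
  let φ : MvPolynomial ι K →+* M := (aeval ψ : MvPolynomial ι K →ₐ[K] M).toRingHom
  have hφ : Function.Injective φ := hind
  have hφσ : ∀ p, φ (shiftHom σ c p) = τ (φ p) := aeval_shiftHom hστ hψ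
  have hφC : ∀ a, φ (C a) = algebraMap K M a := fun a => aeval_C ψ a
  suffices key : ∀ W : Polynomial (MvPolynomial ι K), W.eval₂ φ z = 0 → W = 0 by
    rw [AlgebraicIndependent, injective_iff_map_eq_zero]
    intro p hp
    have h1 := eval₂_optionEquivLeft (fun o : Option ι => o.elim z ψ) p
    rw [hp] at h1
    simpa using key _ h1
  by_contra! hdep
  obtain ⟨W, ⟨hW, hW0⟩, hmin⟩ := WellFounded.has_min
    (measure (fun W : Polynomial (MvPolynomial ι K) => W.natDegree)).wf
    {W | W.eval₂ φ z = 0 ∧ W ≠ 0} hdep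
  set r := W.natDegree
  have hlc : W.coeff r ≠ 0 := Polynomial.leadingCoeff_ne_zero.2 hW0
  -- Applying `τ` to the relation `W(z) = 0` gives `V(z) = 0`, since `τ z = t z`. By minimality `V`
  -- is proportional to `W`.
  let V : Polynomial (MvPolynomial ι K) := (W.map (shiftHom σ c)).comp (Polynomial.C (C t) * Polynomial.X)
  have hVcoeff : ∀ e, V.coeff e = shiftHom σ c (W.coeff e) * C t ^ e := fun e => by
    simp [V, Polynomial.comp_C_mul_X_coeff]
  have hVdeg : V.natDegree ≤ r := by
    refine Polynomial.natDegree_le_iff_coeff_eq_zero.2 fun e he => ?_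
    rw [hVcoeff, Polynomial.coeff_eq_zero_of_natDegree_lt he, map_zero, zero_mul]
  have hV : V.eval₂ φ z = 0 := by
    have h1 : V.eval₂ φ z = τ (W.eval₂ φ z) := by
      rw [Polynomial.hom_eval₂, hτz]
      simp only [V, Polynomial.eval₂_comp, Polynomial.eval₂_map, Polynomial.eval₂_mul,
        Polynomial.eval₂_C, Polynomial.eval₂_X, hφC]
      congr 1
      exact RingHom.ext hφσ
    rw [h1, hW, map_zero]
  have hU : Polynomial.C (V.coeff r) * W = Polynomial.C (W.coeff r) * V := by
    by_contra hne
    have hne' := sub_ne_zero.2 hne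
    refine hmin _ ⟨by simp [Polynomial.eval₂_mul, hW, hV], hne'⟩ ?_
    have hle : (Polynomial.C (V.coeff r) * W - Polynomial.C (W.coeff r) * V).natDegree ≤ r :=
      (Polynomial.natDegree_sub_le _ _).trans (max_le (Polynomial.natDegree_C_mul_le _ _)
        ((Polynomial.natDegree_C_mul_le _ _).trans hVdeg))
    refine lt_of_le_of_ne hle fun heq => Polynomial.leadingCoeff_ne_zero.2 hne' ?_
    rw [Polynomial.leadingCoeff, heq]
    simp only [Polynomial.coeff_sub, Polynomial.coeff_C_mul]
    ring
  -- If `a`, `b` are the leading coefficients of `W.coeff r`, `W.coeff e`, proportionality gives `t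
  -- ^ (r - e) * σ (a / b) = a / b`, which `hK` excludes for `e < r`. So `W` is a monomial in `z`.
  have hcoeff : ∀ e, e ≠ r → W.coeff e = 0 := by
    intro e he
    by_contra hWe
    have her : e ≤ r := Polynomial.le_natDegree_of_ne_zero hWe
    have h1 := congrArg (fun p : Polynomial (MvPolynomial ι K) => m.leadingCoeff (p.coeff e)) hU
    simp only [Polynomial.coeff_C_mul, hVcoeff, MonomialOrder.leadingCoeff_mul,
      MonomialOrder.leadingCoeff_pow, MonomialOrder.leadingCoeff_C, leadingCoeff_shiftHom] at h1
    have ha : m.leadingCoeff (W.coeff r) ≠ 0 := by simpa using hlc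
    have hb : m.leadingCoeff (W.coeff e) ≠ 0 := by simpa using hWe
    have hσb : σ (m.leadingCoeff (W.coeff e)) ≠ 0 := by simpa using hb
    have h2 := hK (m.leadingCoeff (W.coeff r) / m.leadingCoeff (W.coeff e)) (r - e)
      (div_ne_zero ha hb) (by
        rw [map_div₀]
        field_simp
        have hte := pow_ne_zero e ht
        apply mul_left_cancel₀ hte
        have h3 : t ^ e * t ^ (r - e) = t ^ r := by rw [← pow_add]; congr 1; omega
        linear_combination h1 + m.leadingCoeff (W.coeff e) *
          σ (m.leadingCoeff (W.coeff r)) * h3)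
    omega
  have hWr : W = Polynomial.C (W.coeff r) * Polynomial.X ^ r := by
    ext1 e
    rw [Polynomial.coeff_C_mul_X_pow]
    split_ifs with h
    · rw [h]
    · exact hcoeff e h
  rw [hWr] at hW
  simp only [Polynomial.eval₂_mul, Polynomial.eval₂_C, Polynomial.eval₂_X_pow] at hW
  rcases mul_eq_zero.1 hW with h | h
  · exact hlc (hφ (by rw [h, map_zero]))
  · exact pow_ne_zero r hz h

end KolchinOstrowski

/-! ### Poles of rational functions under the shift `t ↦ t + 1` -/

section RationalShift

open Polynomial

variable {k K : Type*} [Field k] [Field K] [Algebra k[X] K]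

/-- A rational function `g` over `k` has a representation whose denominator does not vanish at
`a`. -/
def RegularAt (a : k) (g : K) : Prop :=
  ∃ p q : k[X], q.eval a ≠ 0 ∧ g * algebraMap k[X] K q = algebraMap k[X] K p

theorem RegularAt.sub {a : k} {g h : K} (hg : RegularAt a g) (hh : RegularAt a h) :
    RegularAt a (g - h) := by
  obtain ⟨p, q, hq, h1⟩ := hg
  obtain ⟨p', q', hq', h2⟩ := hh
  refine ⟨p * q' - p' * q, q * q', by simp [hq, hq'], ?_⟩
  simp only [map_sub, map_mul]
  linear_combination (algebraMap k[X] K q') * h1 - (algebraMap k[X] K q) * h2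

theorem RegularAt.add {a : k} {g h : K} (hg : RegularAt a g) (hh : RegularAt a h) :
    RegularAt a (g + h) := by
  obtain ⟨p, q, hq, h1⟩ := hg
  obtain ⟨p', q', hq', h2⟩ := hh
  refine ⟨p * q' + p' * q, q * q', by simp [hq, hq'], ?_⟩
  simp only [map_add, map_mul]
  linear_combination (algebraMap k[X] K q') * h1 + (algebraMap k[X] K q) * h2

/-- `σ` is the shift `g(t) ↦ g(t + 1)` on the rational functions. -/
def IsShift (σ : K →+* K) : Prop :=
  ∀ p : k[X], σ (algebraMap k[X] K p) = algebraMap k[X] K (taylor 1 p)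

variable {σ : K →+* K}

theorem RegularAt.shift (hσ : IsShift (k := k) σ) {a : k} {g : K} (hg : RegularAt (a + 1) g) :
    RegularAt a (σ g) := by
  obtain ⟨p, q, hq, h⟩ := hg
  refine ⟨taylor 1 p, taylor 1 q, by rwa [taylor_eval], ?_⟩
  rw [← hσ, ← hσ, ← map_mul, h]

theorem RegularAt.of_shift (hσ : IsShift (k := k) σ) {a : k} {g : K} (hg : RegularAt a (σ g)) :
    RegularAt (a + 1) g := by
  obtain ⟨p, q, hq, h⟩ := hg
  refine ⟨taylor (-1) p, taylor (-1) q, ?_, σ.injective ?_⟩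
  · rw [taylor_eval]; simpa using hq
  · rw [map_mul, hσ, hσ, taylor_taylor, taylor_taylor]
    simpa using h

variable [IsFractionRing k[X] K]

theorem exists_fraction_eq (g : K) : ∃ p q : k[X], q ≠ 0 ∧
    g * algebraMap k[X] K q = algebraMap k[X] K p := by
  obtain ⟨⟨p, q⟩, h⟩ := IsLocalization.surj (nonZeroDivisors k[X]) g
  exact ⟨p, q, nonZeroDivisors.ne_zero q.2, h⟩

/-- The numerator has degree below `N`; regularity at `0` makes it divisible by `X ^ N`, so its
coefficients vanish. -/
theorem eq_zero_of_regularAt_zero {s : Finset ℕ} {l : ℕ → k} {r : K} {N : ℕ}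
    (hN : ∀ i ∈ s, i < N) (hr : r * algebraMap k[X] K X ^ N =
      algebraMap k[X] K (∑ i ∈ s, C (l i) * X ^ (N - 1 - i)))
    (hreg : RegularAt (0 : k) r) : ∀ i ∈ s, l i = 0 := by
  obtain ⟨p, q, hq, h⟩ := hreg
  set S := ∑ i ∈ s, C (l i) * X ^ (N - 1 - i)
  have h1 : S * q = X ^ N * p := by
    apply IsFractionRing.injective k[X] K
    rw [map_mul, map_mul, ← hr, ← h, map_pow]
    ring
  have hcop : IsCoprime (X ^ N : k[X]) q := by
    apply IsCoprime.pow_left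
    refine (irreducible_X.coprime_iff_not_dvd).2 fun hdvd => hq ?_
    rwa [X_dvd_iff, coeff_zero_eq_eval_zero] at hdvd
  have h2 : (X ^ N : k[X]) ∣ S := hcop.dvd_of_dvd_mul_right ⟨p, h1⟩
  have hcoeff : ∀ i ∈ s, S.coeff (N - 1 - i) = l i := by
    intro i hi
    simp only [S, finsetSum_coeff, coeff_C_mul_X_pow]
    rw [Finset.sum_eq_single i]
    · simp
    · intro j hj hji
      rw [if_neg]
      have := hN i hi
      have := hN j hj
      omega
    · exact fun h => absurd hi h
  intro i hi
  rw [← hcoeff i hi]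
  have := hN i hi
  exact X_pow_dvd_iff.1 h2 _ (by omega)

variable [CharZero k]

theorem finite_intCast_root {q : k[X]} (hq : q ≠ 0) : {n : ℤ | q.eval (n : k) = 0}.Finite :=
  (Polynomial.finite_setOfPred_isRoot hq).preimage (Int.cast_injective.injOn)

theorem exists_forall_eval_ne_zero {q : k[X]} (hq : q ≠ 0) :
    ∃ N : ℕ, ∀ n : ℤ, (N : ℤ) ≤ |n| → q.eval (n : k) ≠ 0 := by
  obtain ⟨N, hN⟩ := ((finite_intCast_root hq).image Int.natAbs).bddAbove
  refine ⟨N + 1, fun n hn h => ?_⟩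
  have h1 : n.natAbs ≤ N := hN ⟨n, h, rfl⟩
  rw [Int.abs_eq_natAbs] at hn
  omega

/-- If `g(t + 1) - g(t)` has no pole at a nonzero integer, then it has none at `0`. -/
theorem regularAt_zero_of_telescoping (hσ : IsShift (k := k) σ) {g r : K} (hr : σ g + r = g)
    (hreg : ∀ n : ℤ, n ≠ 0 → RegularAt (n : k) r) : RegularAt (0 : k) r := by
  obtain ⟨p, q, hq, h⟩ := exists_fraction_eq (k := k) g
  obtain ⟨N, hN⟩ := exists_forall_eval_ne_zero hq
  have hlarge : ∀ n : ℤ, (N : ℤ) ≤ |n| → RegularAt (n : k) g := fun n hn => ⟨p, q, hN n hn, h⟩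
  have hσg : σ g = g - r := eq_sub_of_add_eq hr
  have h1 : RegularAt (1 : k) g := by
    -- Descent from `N + 1`, beyond all integer poles of `g`: regularity of `g` at `n + 1` gives
    -- that of `σ g` at `n`, hence that of `g = σ g + r` at `n` as long as `n ≠ 0`. It stops at `1`.
    have hdown : ∀ j : ℕ, RegularAt (((N + 1 - j : ℤ) : ℤ) : k) g ∨ (N + 1 : ℤ) - j < 1 := by
      intro j
      induction j with
      | zero => exact Or.inl (hlarge _ (by rw [abs_of_nonneg] <;> push_cast <;> omega))
      | succ j ih =>
        by_cases hj : (N + 1 : ℤ) - (j + 1 : ℕ) < 1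
        · exact Or.inr hj
        left
        rcases ih with ih | ih
        · have h2 : RegularAt (((N + 1 - (j + 1 : ℕ) : ℤ) : ℤ) : k) (σ g) := by
            apply RegularAt.shift hσ
            convert ih using 1
            push_cast; ring
          have h3 := h2.add (hreg _ (by omega))
          rwa [hr] at h3
        · push_cast at hj; omega
    have := (hdown N).resolve_right (by omega)
    simpa using this
  have h0 : RegularAt (0 : k) g := by
    -- Ascent from `-N - 1`: at `n ≠ 0`, `σ g = g - r` is regular, so `g` is regular at `n + 1`. It
    -- reaches `0`, and then `r = g - σ g` is regular at `0`.
    have hup : ∀ j : ℕ, RegularAt (((-N - 1 + j : ℤ) : ℤ) : k) g ∨ 0 < -(N : ℤ) - 1 + j := by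
      intro j
      induction j with
      | zero => exact Or.inl (hlarge _ (by rw [abs_of_nonpos] <;> push_cast <;> omega))
      | succ j ih =>
        by_cases hj : 0 < -(N : ℤ) - 1 + (j + 1 : ℕ)
        · exact Or.inr hj
        left
        rcases ih with ih | ih
        · have h2 := (ih.sub (hreg (-N - 1 + j) (by push_cast at hj; omega)))
          rw [← hσg] at h2
          have h3 := h2.of_shift hσ
          convert h3 using 1
          push_cast; ring
        · push_cast at hj; omega
    have := (hup (N + 1)).resolve_right (by push_cast; omega)
    simpa using this
  have h2 : RegularAt (0 : k) (σ g) := RegularAt.shift hσ (by simpa using h1)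
  have h3 := h0.sub h2
  rwa [hσg, sub_sub_cancel] at h3

/-- The derivatives of `1/t` do not satisfy a telescoping relation over the rational functions. -/
theorem eq_zero_of_telescoping_inv (hσ : IsShift (k := k) σ) {s : Finset ℕ} {l c : ℕ → k}
    (hc : ∀ i, c i ≠ 0) {g : K}
    (h : σ g + ∑ i ∈ s, algebraMap k[X] K (C (l i)) *
      (algebraMap k[X] K (C (c i)) / algebraMap k[X] K X ^ (i + 1)) = g) :
    ∀ i ∈ s, l i = 0 := by
  set r := ∑ i ∈ s, algebraMap k[X] K (C (l i)) *
      (algebraMap k[X] K (C (c i)) / algebraMap k[X] K X ^ (i + 1)) with hr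
  -- `X ^ N` clears all the denominators `X ^ (i + 1)`, and the exponents `N - 1 - i` are distinct
  -- because the subtraction does not truncate.
  obtain ⟨N, hN⟩ : ∃ N, ∀ i ∈ s, i < N := ⟨s.sup id + 1, fun i hi =>
    Nat.lt_succ_of_le (Finset.le_sup (f := id) hi)⟩
  have hX : algebraMap k[X] K X ≠ 0 := by
    simp
  have hr' : r * algebraMap k[X] K X ^ N =
      algebraMap k[X] K (∑ i ∈ s, C (l i * c i) * X ^ (N - 1 - i)) := by
    rw [hr, Finset.sum_mul, map_sum]
    refine Finset.sum_congr rfl fun i hi => ?_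
    have h1 : algebraMap k[X] K X ^ N =
        algebraMap k[X] K X ^ (i + 1) * algebraMap k[X] K X ^ (N - 1 - i) := by
      rw [← pow_add]; congr 1; have := hN i hi; omega
    rw [h1, C_mul, map_mul, map_mul, map_pow]
    field_simp
  have hreg : ∀ n : ℤ, n ≠ 0 → RegularAt (n : k) r := by
    intro n hn
    refine ⟨∑ i ∈ s, C (l i * c i) * X ^ (N - 1 - i), X ^ N, ?_, by rw [map_pow]; exact hr'⟩
    simpa using fun h0 => absurd h0 hn
  intro i hi
  have := eq_zero_of_regularAt_zero hN hr' (regularAt_zero_of_telescoping hσ h hreg) i hi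
  exact (mul_eq_zero.1 this).resolve_right (hc i)

/-- Write `g = p / q`. Its values at `N, N + 1, …`, where `q` does not vanish, all equal some `c`,
so `p - c q` has infinitely many roots. -/
theorem exists_eq_C_of_shift_eq (hσ : IsShift (k := k) σ) {g : K} (hg : σ g = g) :
    ∃ c : k, g = algebraMap k[X] K (C c) := by
  obtain ⟨p, q, hq, h⟩ := exists_fraction_eq (k := k) g
  obtain ⟨N, hN⟩ := exists_forall_eval_ne_zero hq
  have hNq : ∀ j : ℕ, q.eval ((N + j : ℕ) : k) ≠ 0 := fun j => by
    have := hN (N + j : ℕ) (by rw [abs_of_nonneg] <;> push_cast <;> omega)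
    exact_mod_cast this
  have hcross : ∀ x : k, p.eval (x + 1) * q.eval x = p.eval x * q.eval (x + 1) := by
    intro x
    have h1 : taylor 1 p * q = p * taylor 1 q := by
      apply IsFractionRing.injective k[X] K
      rw [map_mul, map_mul, ← hσ, ← hσ, ← h, map_mul, hg]
      ring
    simpa [taylor_eval] using congrArg (eval x) h1
  set c := p.eval (N : k) / q.eval (N : k)
  have hval : ∀ j : ℕ, (p - C c * q).eval ((N + j : ℕ) : k) = 0 := by
    intro j
    induction j with
    | zero =>
      have := hNq 0
      rw [add_zero] at this ⊢
      simp only [eval_sub, eval_mul, eval_C, c]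
      field_simp
      ring
    | succ j ih =>
      have h1 := hcross ((N + j : ℕ) : k)
      have h2 : ((N + (j + 1) : ℕ) : k) = ((N + j : ℕ) : k) + 1 := by push_cast; ring
      rw [h2]
      simp only [eval_sub, eval_mul, eval_C] at ih ⊢
      have h3 := hNq j
      apply mul_right_cancel₀ h3
      linear_combination h1 + q.eval (((N + j : ℕ) : k) + 1) * ih
  have hzero : p - C c * q = 0 := by
    refine eq_zero_of_infinite_isRoot _ ?_
    refine Set.Infinite.mono (s := Set.range fun j : ℕ => ((N + j : ℕ) : k)) ?_ ?_
    · rintro _ ⟨j, rfl⟩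
      exact hval j
    · exact Set.infinite_range_of_injective fun i j hij => by
        simpa using hij
  refine ⟨c, ?_⟩
  have hq' : algebraMap k[X] K q ≠ 0 := by
    simpa using (IsFractionRing.injective k[X] K).ne hq
  apply mul_right_cancel₀ hq'
  rw [h, ← map_mul, sub_eq_zero.1 hzero]

omit [CharZero k] in
-- The shift preserves degrees of numerator and denominator, so the left side has degree `n` more
-- than `g`.
theorem eq_zero_of_X_pow_mul_shift_eq (hσ : IsShift (k := k) σ) {g : K} {n : ℕ} (hg : g ≠ 0)
    (h : algebraMap k[X] K X ^ n * σ g = g) : n = 0 := by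
  obtain ⟨p, q, hq, hpq⟩ := exists_fraction_eq (k := k) g
  have hq' : algebraMap k[X] K q ≠ 0 := by
    simpa using (IsFractionRing.injective k[X] K).ne hq
  have hp : p ≠ 0 := by
    rintro rfl
    rw [map_zero] at hpq
    exact (mul_ne_zero hg hq') hpq
  have h1 : X ^ n * (taylor 1 p * q) = p * taylor 1 q := by
    apply IsFractionRing.injective k[X] K
    simp only [map_mul, map_pow]
    rw [← hσ, ← hσ, ← hpq, map_mul]
    linear_combination (σ ((algebraMap k[X] K) q) * (algebraMap k[X] K) q) * h
  have h2 := congrArg natDegree h1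
  have hp1 : taylor 1 p ≠ 0 := by simpa using hp
  have hq1 : taylor 1 q ≠ 0 := by simpa using hq
  rw [natDegree_mul (pow_ne_zero _ X_ne_zero) (mul_ne_zero hp1 hq), natDegree_mul hp1 hq,
    natDegree_mul hp hq1, natDegree_taylor, natDegree_taylor, natDegree_X_pow] at h2
  omega

end RationalShift

/-! ### From a logarithmic derivative back to the function -/

section LogarithmicDerivative

open MvPolynomial

variable {k : Type*} [Field k]

/-- The derivation of `k[X₀, X₁, …]` with `X i ↦ X (i + 1)`. -/
def succDerivation (k : Type*) [Field k] : Derivation k (MvPolynomial ℕ k) (MvPolynomial ℕ k) :=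
  mkDerivation k fun i => X (i + 1)

theorem derivation_aeval_iterate {M : Type*} [CommRing M] [Algebra k M] (δ : Derivation k M M)
    (u : M) (P : MvPolynomial ℕ k) :
    δ (aeval (fun i => δ^[i] u) P) = aeval (fun i => δ^[i] u) (succDerivation k P) := by
  induction P using MvPolynomial.induction_on with
  | C a => simp [succDerivation]
  | add p q hp hq => simp [hp, hq]
  | mul_X p i hp =>
    simp only [map_mul, aeval_X, Derivation.leibniz, smul_eq_mul, hp, map_add]
    simp [succDerivation, mkDerivation_X, Function.iterate_succ_apply']

/-- The polynomials expressing `δ^j z / z` through the iterated derivatives of `δ z / z`. -/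
def logDerivPoly (k : Type*) [Field k] : ℕ → MvPolynomial ℕ k
  | 0 => 1
  | j + 1 => X 0 * logDerivPoly k j + succDerivation k (logDerivPoly k j)

theorem iterate_derivation_eq_mul {M : Type*} [Field M] [Algebra k M] (δ : Derivation k M M)
    {z : M} (hz : z ≠ 0) (j : ℕ) :
    δ^[j] z = z * aeval (fun i => δ^[i] (δ z / z)) (logDerivPoly k j) := by
  induction j with
  | zero => simp [logDerivPoly]
  | succ j ih =>
    rw [Function.iterate_succ_apply', ih, Derivation.leibniz, derivation_aeval_iterate]
    simp only [logDerivPoly, map_add, map_mul, aeval_X, smul_eq_mul, Function.iterate_zero, id]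
    field_simp
    ring

/-- The substitution expressing the derivatives of `z` through `z` and those of `δ z / z`. -/
def logDerivSubst (k K : Type*) [Field k] [Field K] [Algebra k K] :
    MvPolynomial ℕ K →ₐ[K] MvPolynomial (Option ℕ) K :=
  aeval fun j => X none * rename some (map (algebraMap k K) (logDerivPoly k j))

variable {K : Type*} [Field K] [Algebra k K]

theorem aeval_logDerivSubst {M : Type*} [Field M] [Algebra k M] [Algebra K M]
    [IsScalarTower k K M] (δ : Derivation k M M) {z : M} (hz : z ≠ 0) (P : MvPolynomial ℕ K) :
    aeval (fun o : Option ℕ => o.elim z fun i => δ^[i] (δ z / z)) (logDerivSubst k K P) =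
      aeval (fun j => δ^[j] z) P := by
  have h : (aeval (fun o : Option ℕ => o.elim z fun i => δ^[i] (δ z / z))).comp
      (logDerivSubst k K) = aeval (fun j => δ^[j] z) := by
    ext j
    simp only [logDerivSubst, AlgHom.comp_apply, aeval_X, map_mul, aeval_rename, Option.elim_none,
      iterate_derivation_eq_mul δ hz j, aeval_map_algebraMap]
    rfl
  exact DFunLike.congr_fun h P

/-- It suffices to evaluate in the generic differential field, the fractions of `K[X₀, X₁, …]` with
`X i ↦ X (i + 1)`. There `z = X₀` has the variables as its derivatives, so the evaluation recovers
the polynomial. -/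
theorem logDerivSubst_injective : Function.Injective (logDerivSubst k K) := by
  let D : Derivation K (FractionRing (MvPolynomial ℕ K)) (FractionRing (MvPolynomial ℕ K)) := fractionDerivation (succDerivation K)
  let δ : Derivation k (FractionRing (MvPolynomial ℕ K)) (FractionRing (MvPolynomial ℕ K)) := D.restrictScalars k
  let z : FractionRing (MvPolynomial ℕ K) := algebraMap (MvPolynomial ℕ K) _ (X 0)
  have hz : z ≠ 0 := by simp [z]
  have hiter : ∀ j, δ^[j] z = algebraMap (MvPolynomial ℕ K) _ (X j) := by
    intro j
    induction j with
    | zero => rfl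
    | succ j ih =>
      rw [Function.iterate_succ_apply', ih]
      refine (fractionDerivation_algebraMap (succDerivation K) _).trans ?_
      simp [succDerivation, mkDerivation_X]
  intro P Q hPQ
  have h1 := aeval_logDerivSubst (k := k) δ hz P
  rw [hPQ, aeval_logDerivSubst δ hz Q] at h1
  have h2 : ∀ P : MvPolynomial ℕ K, aeval (fun j => δ^[j] z) P = algebraMap (MvPolynomial ℕ K) (FractionRing (MvPolynomial ℕ K)) P := by
    intro P
    simp_rw [hiter]
    have h3 := aeval_algebraMap_apply (FractionRing (MvPolynomial ℕ K)) (fun j => (X j : MvPolynomial ℕ K)) P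
    rw [aeval_X_left_apply] at h3
    exact h3
  rw [h2, h2] at h1
  exact (IsFractionRing.injective (MvPolynomial ℕ K) (FractionRing (MvPolynomial ℕ K)) h1).symm

theorem algebraicIndependent_iterate_of_logDeriv {M : Type*} [Field M] [Algebra k M] [Algebra K M]
    [IsScalarTower k K M] (δ : Derivation k M M) {z : M} (hz : z ≠ 0)
    (h : AlgebraicIndependent K fun o : Option ℕ => o.elim z fun i => δ^[i] (δ z / z)) :
    AlgebraicIndependent K fun j => δ^[j] z := by
  intro P Q hPQ
  refine logDerivSubst_injective (k := k) (h ?_)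
  rw [aeval_logDerivSubst δ hz, aeval_logDerivSubst δ hz, hPQ]

end LogarithmicDerivative

/-! ### Hölder's theorem in algebraic form -/

section Hoelder

open Polynomial

variable {k M : Type*} [Field k] [Field M] [Algebra k M]

theorem iterate_derivation_inv (δ : Derivation k M M) {t : M} (ht : t ≠ 0) (hδ : δ t = 1)
    (i : ℕ) : δ^[i] t⁻¹ = algebraMap k M ((-1) ^ i * (i.factorial : k)) / t ^ (i + 1) := by
  induction i with
  | zero => simp
  | succ i ih =>
    rw [Function.iterate_succ_apply', ih, div_eq_mul_inv, Derivation.leibniz,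
      Derivation.map_algebraMap, Derivation.leibniz_inv, Derivation.leibniz_pow, hδ]
    simp only [smul_eq_mul, nsmul_eq_mul, Nat.factorial_succ, map_mul, map_pow, map_natCast,
      map_neg, map_one, Nat.add_sub_cancel]
    push_cast
    field_simp
    ring

/-- **Hölder's theorem**, algebraically: a nonzero solution of `z(t + 1) = t z(t)` in a field with
a derivation and a compatible shift is differentially transcendental over the rational functions
of `t`. -/
theorem algebraicIndependent_iterate_of_functional_equation [CharZero k]
    (σ : M →ₐ[k] M) (δ : Derivation k M M) (hσδ : ∀ a, σ (δ a) = δ (σ a))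
    {t : M} (ht : Transcendental k t) (hδt : δ t = 1) (hσt : σ t = t + 1)
    {z : M} (hz : z ≠ 0) (hσz : σ z = t * z) :
    AlgebraicIndependent k (Sum.elim (fun n : ℕ => δ^[n] z) fun _ : Unit => t) := by
  have ht0 : t ≠ 0 := fun h => ht (h ▸ isAlgebraic_zero)
  let K := FractionRing k[X]
  let f : K →ₐ[k] M := IsFractionRing.liftAlgHom (transcendental_iff_injective.1 ht)
  let _ : Algebra K M := f.toRingHom.toAlgebra
  have : IsScalarTower k K M := IsScalarTower.of_algebraMap_eq fun a => (f.commutes a).symm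
  have hfp : ∀ p : k[X], algebraMap K M (algebraMap k[X] K p) = aeval t p := fun p =>
    IsFractionRing.lift_algebraMap (transcendental_iff_injective.1 ht) p
  have hinj : Function.Injective ((algebraMap k[X] K).comp (taylorAlgHom (1 : k)).toRingHom) :=
    (IsFractionRing.injective k[X] K).comp (taylor_injective (1 : k))
  let s : K →+* K := IsFractionRing.lift hinj
  have hs : IsShift (k := k) s := fun p => IsFractionRing.lift_algebraMap hinj p
  have hfs : ∀ a : K, σ.toRingHom (algebraMap K M a) = algebraMap K M (s a) := by
    have h : σ.toRingHom.comp (algebraMap K M) = (algebraMap K M).comp s := by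
      refine IsLocalization.ringHom_ext (nonZeroDivisors k[X]) ?_
      refine Polynomial.ringHom_ext (fun a => ?_) ?_
      · rw [RingHom.comp_apply, RingHom.comp_apply, RingHom.comp_apply, RingHom.comp_apply, hs, hfp, hfp]
        simp
      · rw [RingHom.comp_apply, RingHom.comp_apply, RingHom.comp_apply, RingHom.comp_apply, hs, hfp, hfp]
        simp [hσt]
    exact fun a => DFunLike.congr_fun h a
  let c : ℕ → K := fun i => algebraMap k[X] K (C ((-1) ^ i * (i.factorial : k))) /
    algebraMap k[X] K X ^ (i + 1)
  have hc : ∀ i, algebraMap K M (c i) = δ^[i] t⁻¹ := fun i => by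
    rw [iterate_derivation_inv δ ht0 hδt i]
    simp only [c, map_div₀, map_pow, hfp, aeval_C, aeval_X]
  -- The logarithmic derivative turns the multiplicative equation for `z` into an additive one.
  have hu : σ (δ z / z) = δ z / z + t⁻¹ := by
    rw [map_div₀, hσδ, hσz, Derivation.leibniz, hδt]
    simp only [smul_eq_mul]
    field_simp
  have hψ : ∀ i, σ.toRingHom (δ^[i] (δ z / z)) = δ^[i] (δ z / z) + algebraMap K M (c i) := by
    intro i
    rw [hc]
    induction i with
    | zero => exact hu
    | succ i ih =>
      simp only [Function.iterate_succ_apply']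
      refine (hσδ _).trans ?_
      rw [show σ (δ^[i] (δ z / z)) = _ from ih, map_add]
  -- The lexicographic order on monomials is well-founded when the indices have no infinite
  -- ascending chain, hence the reversed order on `ℕ`.
  let m : MonomialOrder ℕᵒᵈ := MonomialOrder.lex
  have hind : AlgebraicIndependent K fun i : ℕᵒᵈ => δ^[OrderDual.ofDual i] (δ z / z) := by
    by_contra hdep
    obtain ⟨S, l, g, ⟨i, hi, hli⟩, hl, hg⟩ := exists_telescoper_of_not_algebraicIndependent m hfs
      (c := fun i => c (OrderDual.ofDual i)) (fun i => hψ (OrderDual.ofDual i)) hdep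
    choose l' hl' using fun i => exists_eq_C_of_shift_eq hs (hl i)
    have hsum : s g + ∑ i ∈ S.map OrderDual.ofDual.toEmbedding,
        algebraMap k[X] K (C (l' (OrderDual.toDual i))) * c i = g := by
      rw [Finset.sum_map]
      simpa [← hl'] using hg
    have h0 := eq_zero_of_telescoping_inv hs (c := fun i => (-1) ^ i * (i.factorial : k))
      (fun i => mul_ne_zero (by simp) (by exact_mod_cast i.factorial_ne_zero)) hsum
      (OrderDual.ofDual i) (by simpa using hi)
    apply hli
    rw [hl', show l' i = 0 from h0]
    simp
  have hX0 : algebraMap k[X] K X ≠ 0 := by simp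
  have hopt := algebraicIndependent_option_of_multiplicative m hfs
    (c := fun i => c (OrderDual.ofDual i)) (fun i => hψ (OrderDual.ofDual i)) hind hX0 hz
    (by rw [hfp, aeval_X]; exact hσz) (fun a n ha h => eq_zero_of_X_pow_mul_shift_eq hs ha h)
  have hopt' : AlgebraicIndependent K fun o : Option ℕ => o.elim z fun i => δ^[i] (δ z / z) := by
    have h := hopt.comp (Option.map OrderDual.toDual)
      (Option.map_injective OrderDual.toDual.injective)
    have heq : (fun o : Option ℕ => o.elim z fun i => δ^[i] (δ z / z)) =
        (fun o : Option ℕᵒᵈ => o.elim z fun i => δ^[OrderDual.ofDual i] (δ z / z)) ∘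
          Option.map OrderDual.toDual := by
      funext o
      cases o <;> rfl
    rw [heq]
    exact h
  have hiter := algebraicIndependent_iterate_of_logDeriv (k := k) (K := K) δ hz hopt'
  have htX : AlgebraicIndependent k fun _ : Unit => t := by
    rw [algebraicIndependent_unique_type_iff]
    exact ht
  refine htX.sumElim_of_tower (S := K) ?_ hiter
  rintro _ ⟨-, rfl⟩
  exact ⟨algebraMap k[X] K X, by rw [hfp, aeval_X]⟩

end Hoelder

/-! ### Joint independence of `x`, `t` and the derivatives of `y` -/

section DifferentialFamily

/-- The family consisting of `x`, `t` and the iterated derivatives of `y`. -/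
def diffFamily {M : Type*} (δ : M → M) (x t y : M) : Option (ℕ ⊕ Unit) → M
  | none => x
  | some (Sum.inl n) => δ^[n] y
  | some (Sum.inr _) => t

theorem comp_diffFamily {M N : Type*} {δ : M → M} {δ' : N → N} (φ : M → N)
    (h : ∀ a, φ (δ a) = δ' (φ a)) (x t y : M) :
    φ ∘ diffFamily δ x t y = diffFamily δ' (φ x) (φ t) (φ y) := by
  funext o
  rcases o with _ | n | _
  · rfl
  · exact (Function.Semiconj.iterate_right (f := φ) (ga := δ) (gb := δ') h n) y
  · rfl

/-- Joint independence over the constants moves along injective homomorphisms without a change of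
base field; the field `k(x, t)` enters only at the end, in `isDiffTranscendental_adjoin`. -/
theorem algebraicIndependent_diffFamily_iff {k M N : Type*} [Field k] [CommRing M] [CommRing N]
    [Algebra k M] [Algebra k N] {δ : M → M} {δ' : N → N} (φ : M →ₐ[k] N)
    (hφ : Function.Injective φ) (h : ∀ a, φ (δ a) = δ' (φ a)) {x t y : M} {x' t' y' : N}
    (hx : φ x = x') (ht : φ t = t') (hy : φ y = y') :
    AlgebraicIndependent k (diffFamily δ' x' t' y') ↔
      AlgebraicIndependent k (diffFamily δ x t y) := by
  subst hx ht hy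
  rw [← comp_diffFamily φ h]
  exact AlgHom.algebraicIndependent_iff φ hφ

theorem isDiffTranscendental_adjoin {k M : Type*} [Field k] [Field M] [Algebra k M]
    {δ : Derivation k M M} {x t y : M} (h : AlgebraicIndependent k (diffFamily δ x t y)) :
    IsDiffTranscendental (IntermediateField.adjoin k {x, t}) δ y := by
  let e : ℕ ⊕ Option Unit → Option (ℕ ⊕ Unit) :=
    Sum.elim (fun n => some (Sum.inl n)) (fun o => o.map Sum.inr)
  have he : Function.Injective e := by
    rintro (a | _ | a) (b | _ | b) hab <;> simp_all [e]
  have h1 : AlgebraicIndependent k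
      (Sum.elim (fun n : ℕ => δ^[n] y) fun o : Option Unit => o.elim x fun _ => t) := by
    have heq : (Sum.elim (fun n : ℕ => δ^[n] y) fun o : Option Unit => o.elim x fun _ => t) =
        diffFamily δ x t y ∘ e := by
      funext o
      rcases o with _ | _ | _ <;> rfl
    rw [heq]
    exact h.comp e he
  have h2 := (AlgebraicIndependent.sumElim_iff.1 h1).2
  have hrange : Set.range (fun o : Option Unit => o.elim x fun _ => t) = {x, t} := by
    ext a
    simp [Option.exists, eq_comm]
  rw [hrange] at h2
  exact IntermediateField.algebraicIndependent_adjoin_iff.2 h2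

end DifferentialFamily

/-! ### Functoriality of the differential field of fractions -/

section FractionMap

variable {k A B : Type*} [Field k] [CommRing A] [IsDomain A] [Algebra k A]
  [CommRing B] [IsDomain B] [Algebra k B]

/-- The map of fields of fractions induced by an injective homomorphism of domains. -/
def fractionMap (φ : A →ₐ[k] B) (hφ : Function.Injective φ) :
    FractionRing A →ₐ[k] FractionRing B :=
  IsFractionRing.liftAlgHom (g := (Algebra.algHom k B (FractionRing B)).comp φ)
    ((IsFractionRing.injective B (FractionRing B)).comp hφ)

theorem fractionMap_algebraMap (φ : A →ₐ[k] B) (hφ : Function.Injective φ) (a : A) :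
    fractionMap φ hφ (algebraMap A (FractionRing A) a) =
      algebraMap B (FractionRing B) (φ a) :=
  IsFractionRing.lift_algebraMap (g := ((Algebra.algHom k B (FractionRing B)).comp φ).toRingHom)
    ((IsFractionRing.injective B (FractionRing B)).comp hφ) a

theorem fractionMap_fractionDerivation (φ : A →ₐ[k] B) (hφ : Function.Injective φ)
    (δ : Derivation k A A) (δ' : Derivation k B B) (h : ∀ a, φ (δ a) = δ' (φ a))
    (z : FractionRing A) :
    fractionMap φ hφ (fractionDerivation δ z) = fractionDerivation δ' (fractionMap φ hφ z) := by
  obtain ⟨a, b, hb, rfl⟩ := IsFractionRing.div_surjective (A := A) z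
  have hb := nonZeroDivisors.ne_zero hb
  have hφb : φ b ≠ 0 := (map_ne_zero_iff φ hφ).2 hb
  rw [map_div₀ (fractionMap φ hφ), fractionMap_algebraMap, fractionMap_algebraMap]
  change fractionMap φ hφ (fractionDeriv δ _) = fractionDeriv δ' _
  rw [fractionDeriv_div δ a b hb, fractionDeriv_div δ' _ _ hφb, quotientRule, quotientRule,
    map_div₀, map_pow, fractionMap_algebraMap, fractionMap_algebraMap]
  simp [h]

theorem algebraicIndependent_diffFamily_algebraMap_iff (δ : Derivation k A A) (x t y : A) :
    AlgebraicIndependent k (diffFamily (fractionDerivation δ) (algebraMap A (FractionRing A) x)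
      (algebraMap A (FractionRing A) t) (algebraMap A (FractionRing A) y)) ↔
      AlgebraicIndependent k (diffFamily δ x t y) :=
  algebraicIndependent_diffFamily_iff (Algebra.algHom k A (FractionRing A))
    (IsFractionRing.injective A (FractionRing A))
    (fun a => (fractionDerivation_algebraMap δ a).symm) rfl rfl rfl

theorem algebraicIndependent_diffFamily_div_iff (φ : A →ₐ[k] B) (hφ : Function.Injective φ)
    (δ : Derivation k A A) (δ' : Derivation k B B) (h : ∀ a, φ (δ a) = δ' (φ a)) {a b : A}
    (hb : b ≠ 0) {f : B} (hf : φ a = f * φ b) (x t : A) :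
    AlgebraicIndependent k (diffFamily (fractionDerivation δ) (algebraMap A (FractionRing A) x)
      (algebraMap A (FractionRing A) t)
      (algebraMap A (FractionRing A) a / algebraMap A (FractionRing A) b)) ↔
      AlgebraicIndependent k (diffFamily δ' (φ x) (φ t) f) := by
  have hb' : algebraMap B (FractionRing B) (φ b) ≠ 0 :=
    (map_ne_zero_iff _ (IsFractionRing.injective B (FractionRing B))).2
      ((map_ne_zero_iff φ hφ).2 hb)
  rw [← algebraicIndependent_diffFamily_algebraMap_iff δ']
  refine (algebraicIndependent_diffFamily_iff (fractionMap φ hφ) (fractionMap φ hφ).injective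
    (fractionMap_fractionDerivation φ hφ δ δ' h) (fractionMap_algebraMap φ hφ x)
    (fractionMap_algebraMap φ hφ t) ?_).symm
  rw [map_div₀, fractionMap_algebraMap, fractionMap_algebraMap, hf, map_mul,
    mul_div_cancel_right₀ _ hb']

end FractionMap

/-! ### Identity theorem, translation and restriction -/

namespace Domain₂

variable {D E : Domain₂}

theorem ext_of_eqOn_open {f g : D.Holo} {W : Set (ℂ × ℂ)} (hW : IsOpen W) (hne : W.Nonempty)
    (hWD : W ⊆ D.carrier) (h : ∀ (z : ℂ × ℂ) (hz : z ∈ W), f.1 ⟨z, hWD hz⟩ = g.1 ⟨z, hWD hz⟩) :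
    f = g := by
  obtain ⟨z, hz⟩ := hne
  have hev : D.extendZero f.1 =ᶠ[𝓝 z] D.extendZero g.1 := by
    filter_upwards [hW.mem_nhds hz] with w hw
    rw [D.extendZero_apply f.1 ⟨w, hWD hw⟩, D.extendZero_apply g.1 ⟨w, hWD hw⟩]
    exact h w hw
  have := AnalyticOnNhd.eqOn_of_preconnected_of_eventuallyEq f.2 g.2
    D.isConnected.isPreconnected (hWD hz) hev
  refine Subtype.ext (funext fun w => ?_)
  simpa [extendZero_apply] using this w.2

theorem derivT_iterate_apply {f : D.Holo} {F : ℂ × ℂ → ℂ} (h : ∀ z : D.carrier, F z = f.1 z)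
    (n : ℕ) (z : D.carrier) :
    (D.derivT^[n] f).1 z = iteratedDeriv n (fun t => F (t, z.1.2)) z.1.1 := by
  induction n generalizing z with
  | zero => simpa using (h z).symm
  | succ n ih =>
    rw [Function.iterate_succ_apply', iteratedDeriv_succ,
      derivT_apply (F := fun w => iteratedDeriv n (fun t => F (t, w.2)) w.1)
        (fun w => (ih w).symm)]

/-- The pullback of functions along `(t, x) ↦ (t + c, x)`. -/
def translate (c : ℂ) (h : ∀ z ∈ E.carrier, (z.1 + c, z.2) ∈ D.carrier) :
    D.Holo →ₐ[ℂ] E.Holo where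
  toFun f := ⟨fun z => f.1 ⟨(z.1.1 + c, z.1.2), h z z.2⟩, by
    have hF : AnalyticOnNhd ℂ (fun z : ℂ × ℂ => D.extendZero f.1 (z.1 + c, z.2)) E.carrier :=
      fun z hz => (f.2 _ (h z hz)).comp (f := fun z : ℂ × ℂ => (z.1 + c, z.2))
        ((analyticAt_fst.add analyticAt_const).prod analyticAt_snd)
    exact analyticOnNhd_extendZero hF fun z => D.extendZero_apply f.1 ⟨_, h z z.2⟩⟩
  map_one' := rfl
  map_mul' _ _ := rfl
  map_zero' := rfl
  map_add' _ _ := rfl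
  commutes' _ := rfl

variable {c : ℂ} (h : ∀ z ∈ E.carrier, (z.1 + c, z.2) ∈ D.carrier)

/-- The translate of `E` is a nonempty open subset of the connected `D`, so the identity theorem
applies. -/
theorem translate_injective : Function.Injective (translate c h) := by
  intro f g hfg
  let e : ℂ × ℂ ≃ₜ ℂ × ℂ := (Homeomorph.addRight c).prodCongr (Homeomorph.refl ℂ)
  have he : ∀ z, e z = (z.1 + c, z.2) := fun z => rfl
  have hsub : e '' E.carrier ⊆ D.carrier := by
    rintro _ ⟨z, hz, rfl⟩
    exact h z hz
  refine ext_of_eqOn_open (e.isOpenMap _ E.isOpen) (E.isConnected.nonempty.image e) hsub ?_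
  rintro _ ⟨z, hz, rfl⟩
  exact congrFun (congrArg Subtype.val hfg) ⟨z, hz⟩

theorem translate_derivT (f : D.Holo) :
    translate c h (D.derivT f) = E.derivT (translate c h f) := by
  refine Subtype.ext (funext fun z => ?_)
  rw [derivT_apply (F := fun w => D.extendZero f.1 (w.1 + c, w.2))
    (fun w => D.extendZero_apply f.1 ⟨_, h w w.2⟩) z]
  refine (derivT_apply (D.extendZero_apply f.1) ⟨_, h z z.2⟩).trans ?_
  exact (deriv_comp_add_const (fun t => D.extendZero f.1 (t, z.1.2)) c z.1.1).symm

theorem translate_coordT : translate c h D.coordT = E.coordT + algebraMap ℂ E.Holo c := rfl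

/-- The restriction of functions to a smaller domain. -/
def restrict (h : E.carrier ⊆ D.carrier) : D.Holo →ₐ[ℂ] E.Holo :=
  translate 0 fun z hz => by simpa using h hz

theorem restrict_apply (h : E.carrier ⊆ D.carrier) (f : D.Holo) (z : E.carrier) :
    (restrict h f).1 z = f.1 ⟨z, h z.2⟩ := by
  exact congrArg f.1 (Subtype.ext (Prod.ext (add_zero _) rfl))

theorem restrict_coordT (h : E.carrier ⊆ D.carrier) : restrict h D.coordT = E.coordT := by
  rw [restrict, translate_coordT, map_zero, add_zero]

/-- Being differentially transcendental over the rational functions, for a holomorphic function. -/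
def IsIndependent (f : D.Holo) : Prop :=
  AlgebraicIndependent ℂ (diffFamily D.derivT D.coordX D.coordT f)

theorem isIndependent_restrict_iff (h : E.carrier ⊆ D.carrier) (f : D.Holo) :
    IsIndependent (restrict h f) ↔ IsIndependent f :=
  algebraicIndependent_diffFamily_iff (restrict h) (translate_injective _) (translate_derivT _)
    rfl (restrict_coordT h) rfl

theorem exists_domain_subset {W : Set (ℂ × ℂ)} (hW : IsOpen W) (hne : W.Nonempty) :
    ∃ B : Domain₂, B.carrier ⊆ W := by
  obtain ⟨z, hz⟩ := hne
  obtain ⟨r, hr, hball⟩ := Metric.isOpen_iff.1 hW z hz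
  exact ⟨⟨Metric.ball z r, Metric.isOpen_ball,
    (convex_ball z r).isConnected ⟨z, Metric.mem_ball_self hr⟩⟩, hball⟩

end Domain₂

/-! ### Reduction of all branches to the principal one -/

namespace IncompleteGamma

open Domain₂

theorem IsHolomorphicBranch.isIndependent
    (hp : ∀ g : principalDomain.Holo,
      (∀ z : principalDomain.carrier, g.1 z = gammaIntegral z.1.1 z.1.2) → IsIndependent g)
    {D : Domain₂} {f : D.Holo} (hf : IsHolomorphicBranch D f) : IsIndependent f := by
  induction hf with
  | principal g hg => exact hp g hg
  | continuation f g hf W hW hWne hWD hWE hfg ih =>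
    -- The overlap `W` need not be connected; a ball inside it is a domain on which both elements
    -- restrict to the same function.
    obtain ⟨B, hB⟩ := exists_domain_subset hW hWne
    rw [← isIndependent_restrict_iff (hB.trans hWE)]
    rw [← isIndependent_restrict_iff (hB.trans hWD)] at ih
    convert ih using 1
    refine Subtype.ext (funext fun z => ?_)
    rw [restrict_apply, restrict_apply]
    exact (hfg z (hB z.2)).symm

theorem IsBranch.isDiffTranscendental
    (hp : ∀ g : principalDomain.Holo,
      (∀ z : principalDomain.carrier, g.1 z = gammaIntegral z.1.1 z.1.2) → IsIndependent g)
    {D : Domain₂} {m : D.Mero} (hm : IsBranch D m) :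
    IsDiffTranscendental D.rationalFunctions D.meroDerivT m := by
  obtain ⟨a, b, hb, rfl, E, f, hED, hf, hab⟩ := hm
  apply isDiffTranscendental_adjoin
  have hinj : Function.Injective (restrict hED) := translate_injective _
  have hfb : restrict hED a = f * restrict hED b := by
    refine Subtype.ext (funext fun z => ?_)
    rw [restrict_apply, hab z]
    change f.1 z * _ = f.1 z * (restrict hED b).1 z
    rw [restrict_apply]
  refine (algebraicIndependent_diffFamily_div_iff (restrict hED) hinj D.derivT E.derivT
    (translate_derivT _) hb hfb D.coordX D.coordT).2 ?_
  rw [restrict_coordT]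
  exact hf.isIndependent hp

end IncompleteGamma

/-! ### Leading coefficients in the limit `x → ∞` -/

section PolynomialLimit

open Filter

/-- After division by `x ^ N` the lower terms tend to `0`, as their coefficients converge, and the
top term tends to `A N`. -/
theorem eq_zero_of_tendsto_of_sum_eq_zero {a : ℕ → ℝ → ℂ} {A : ℕ → ℂ} (N : ℕ)
    (ha : ∀ i, Tendsto (a i) atTop (𝓝 (A i)))
    (h : ∀ x : ℝ, 0 < x → ∑ i ∈ Finset.range (N + 1), a i x * (x : ℂ) ^ i = 0) : A N = 0 := by
  have hterm : ∀ i ∈ Finset.range N,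
      Tendsto (fun x : ℝ => a i x * ((x : ℂ) ^ i / (x : ℂ) ^ N)) atTop (𝓝 0) := by
    intro i hi
    have h1 : Tendsto (fun x : ℝ => ((x ^ i / x ^ N : ℝ) : ℂ)) atTop (𝓝 ((0 : ℝ) : ℂ)) :=
      (Complex.continuous_ofReal.tendsto 0).comp
        (tendsto_pow_div_pow_atTop_zero (Finset.mem_range.1 hi))
    simpa using (ha i).mul h1
  have hsum := (tendsto_finsetSum _ hterm).add (ha N)
  rw [Finset.sum_const_zero, zero_add] at hsum
  refine tendsto_nhds_unique hsum (tendsto_const_nhds.congr' ?_)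
  filter_upwards [eventually_gt_atTop 0] with x hx
  have hx' : (x : ℂ) ^ N ≠ 0 := pow_ne_zero _ (by exact_mod_cast hx.ne')
  have h1 := h x hx
  rw [Finset.sum_range_succ] at h1
  apply mul_right_cancel₀ hx'
  rw [zero_mul, add_mul, Finset.sum_mul, ← h1]
  congr 1
  refine Finset.sum_congr rfl fun i _ => ?_
  field_simp

end PolynomialLimit

/-! ### Evaluation at points -/

namespace Domain₂

variable {D : Domain₂}

/-- Evaluation of holomorphic functions at a point. -/
def evalAt (z : D.carrier) : D.Holo →ₐ[ℂ] ℂ :=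
  (Pi.evalAlgHom ℂ (fun _ : D.carrier => ℂ) z).comp D.Holo.val

theorem ext_evalAt {f g : D.Holo} (h : ∀ z, evalAt z f = evalAt z g) : f = g :=
  Subtype.ext (funext h)

theorem derivT_coordT : D.derivT D.coordT = 1 := by
  refine Subtype.ext (funext fun z => ?_)
  rw [derivT_apply (F := fun z => z.1) (fun _ => rfl) z]
  simp

end Domain₂

/-! ### Hölder's theorem for `Γ` and passage to the incomplete function -/

namespace IncompleteGamma

open Domain₂ Filter

theorem mem_principalDomain {t x : ℂ} :
    (t, x) ∈ principalDomain.carrier ↔ 0 < t.re ∧ x ∈ Complex.slitPlane := Iff.rfl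

theorem differentiableAt_Gamma_of_re_pos {t : ℂ} (ht : 0 < t.re) :
    DifferentiableAt ℂ Complex.Gamma t := by
  refine Complex.differentiableAt_Gamma t fun m h => ?_
  rw [h] at ht
  have : (0 : ℝ) ≤ m := m.cast_nonneg
  simp at ht
  linarith

theorem analyticAt_Gamma_of_re_pos {t : ℂ} (ht : 0 < t.re) : AnalyticAt ℂ Complex.Gamma t := by
  have hopen : IsOpen {t : ℂ | 0 < t.re} := isOpen_lt continuous_const Complex.continuous_re
  exact DifferentiableOn.analyticAt (s := {t : ℂ | 0 < t.re})
    (fun s hs => (differentiableAt_Gamma_of_re_pos hs).differentiableWithinAt)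
    (hopen.mem_nhds ht)

/-- The Gamma function of the variable `t`, on the principal domain. -/
def gammaHolo : principalDomain.Holo :=
  ofAnalytic (fun z => Complex.Gamma z.1) fun _ hz =>
    (analyticAt_Gamma_of_re_pos hz.1).comp analyticAt_fst

/-- The shift `t ↦ t + 1` on the holomorphic functions on the principal domain. -/
def principalShift : principalDomain.Holo →ₐ[ℂ] principalDomain.Holo :=
  translate 1 fun z hz => mem_principalDomain.2
    ⟨by have : 0 < z.1.re := hz.1
        simp; linarith, hz.2⟩

theorem principalShift_injective : Function.Injective principalShift := translate_injective _

theorem principalShift_gammaHolo :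
    principalShift gammaHolo = principalDomain.coordT * gammaHolo := by
  refine Subtype.ext (funext fun z => ?_)
  refine Complex.Gamma_add_one z.1.1 fun h => ?_
  have : 0 < z.1.1.re := z.2.1
  rw [h] at this
  simp at this

theorem gammaHolo_ne_zero : gammaHolo ≠ 0 := by
  intro h
  have h1 := congrFun (congrArg Subtype.val h)
    ⟨(1, 1), mem_principalDomain.2 ⟨by simp, Complex.one_mem_slitPlane⟩⟩
  have h2 : Complex.Gamma 1 = 0 := h1
  simp at h2

theorem transcendental_coordT : Transcendental ℂ principalDomain.coordT := by
  rw [transcendental_iff]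
  intro p hp
  refine Polynomial.eq_zero_of_infinite_isRoot p ?_
  refine Set.Infinite.mono (s := Set.range fun n : ℕ => (n : ℂ) + 1) ?_
    (Set.infinite_range_of_injective fun i j hij => by simpa using hij)
  rintro _ ⟨n, rfl⟩
  have hz : ((n : ℂ) + 1, (1 : ℂ)) ∈ principalDomain.carrier := mem_principalDomain.2
    ⟨by simp; positivity, Complex.one_mem_slitPlane⟩
  have h1 := congrArg (evalAt ⟨_, hz⟩) hp
  rw [← Polynomial.aeval_algHom_apply, map_zero] at h1
  rw [Polynomial.aeval_def, Polynomial.eval₂_eq_eval_map, Algebra.algebraMap_self,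
    Polynomial.map_id] at h1
  exact h1

/-- **Hölder's theorem** for the Gamma function of `t`, over the rational functions of `t`. -/
theorem algebraicIndependent_gammaHolo : AlgebraicIndependent ℂ
    (Sum.elim (fun n : ℕ => principalDomain.derivT^[n] gammaHolo)
      fun _ : Unit => principalDomain.coordT) := by
  let ι : principalDomain.Holo →ₐ[ℂ] principalDomain.Mero :=
    Algebra.algHom ℂ principalDomain.Holo principalDomain.Mero
  have hι : Function.Injective ι := IsFractionRing.injective principalDomain.Holo _
  let σ := fractionMap principalShift principalShift_injective
  have hσ : ∀ f, σ (ι f) = ι (principalShift f) := fractionMap_algebraMap _ _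
  have hδ : ∀ f, principalDomain.meroDerivT (ι f) = ι (principalDomain.derivT f) :=
    fractionDerivation_algebraMap principalDomain.derivT
  have h := algebraicIndependent_iterate_of_functional_equation σ principalDomain.meroDerivT
    (t := ι principalDomain.coordT) (z := ι gammaHolo)
    (fractionMap_fractionDerivation principalShift principalShift_injective principalDomain.derivT
      principalDomain.derivT (translate_derivT _))
    ((transcendental_algebraMap_iff hι).2 transcendental_coordT)
    (by rw [hδ, derivT_coordT, map_one])
    (by rw [hσ, principalShift, translate_coordT, map_one, map_add, map_one])
    ((map_ne_zero_iff _ hι).2 gammaHolo_ne_zero)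
    (by rw [hσ, principalShift_gammaHolo, map_mul])
  rw [← AlgHom.algebraicIndependent_iff ι hι]
  suffices heq : ι ∘ (Sum.elim (fun n : ℕ => principalDomain.derivT^[n] gammaHolo)
      fun _ : Unit => principalDomain.coordT) =
      Sum.elim (fun n : ℕ => principalDomain.meroDerivT^[n] (ι gammaHolo))
        fun _ : Unit => ι principalDomain.coordT by
    rw [heq]
    exact h
  funext o
  rcases o with n | _
  · exact (Function.Semiconj.iterate_right (f := ι) (fun f => (hδ f).symm) n) gammaHolo
  · rfl

/-- If the `t`-derivatives of `γ(t, x)` converge to those of `Γ(t)` as `x → ∞`, then the principal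
branch is independent. -/
theorem isIndependent_of_tendsto
    (hlim : ∀ (n : ℕ) (t : ℂ), 0 < t.re →
      Tendsto (fun x : ℝ => iteratedDeriv n (fun t => gammaIntegral t x) t) atTop
        (𝓝 (iteratedDeriv n Complex.Gamma t)))
    (g : principalDomain.Holo)
    (hg : ∀ z : principalDomain.carrier, g.1 z = gammaIntegral z.1.1 z.1.2) :
    IsIndependent g := by
  rw [IsIndependent, algebraicIndependent_iff]
  intro P hP
  -- `Q` is `P` read as a polynomial in `x`. Its leading coefficient is shown to be a relation for
  -- `Γ`, pointwise in `t`; the coordinate `x₀` plays no role.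
  set Q := MvPolynomial.optionEquivLeft ℂ (ℕ ⊕ Unit) P with hQ
  suffices hlc : Q.leadingCoeff = 0 by
    rw [Polynomial.leadingCoeff_eq_zero, hQ] at hlc
    simpa using hlc
  refine algebraicIndependent_iff.1 algebraicIndependent_gammaHolo _ (ext_evalAt fun z => ?_)
  obtain ⟨⟨t, x₀⟩, hz⟩ := z
  have ht : 0 < t.re := hz.1
  let v : ℝ → ℕ ⊕ Unit → ℂ := fun x =>
    Sum.elim (fun n => iteratedDeriv n (fun t => gammaIntegral t x) t) fun _ => t
  let w : ℕ ⊕ Unit → ℂ := Sum.elim (fun n => iteratedDeriv n Complex.Gamma t) fun _ => t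
  have hvw : Tendsto v atTop (𝓝 w) := by
    rw [tendsto_pi_nhds]
    rintro (n | _)
    · exact hlim n t ht
    · exact tendsto_const_nhds
  have hQw : MvPolynomial.aeval w Q.leadingCoeff = 0 := by
    refine eq_zero_of_tendsto_of_sum_eq_zero (a := fun i x => MvPolynomial.aeval (v x) (Q.coeff i))
      (A := fun i => MvPolynomial.aeval w (Q.coeff i)) Q.natDegree (fun i => ?_) fun x hx => ?_
    · exact ((MvPolynomial.continuous_eval (Q.coeff i)).tendsto w).comp hvw
    · have hzx : (t, (x : ℂ)) ∈ principalDomain.carrier := mem_principalDomain.2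
        ⟨ht, Complex.ofReal_mem_slitPlane.2 hx⟩
      have h1 := congrArg (evalAt ⟨_, hzx⟩) hP
      rw [map_zero, MvPolynomial.comp_aeval_apply, ← eval₂_optionEquivLeft,
        Polynomial.eval₂_eq_sum_range] at h1
      rw [← h1]
      refine Finset.sum_congr rfl fun i _ => ?_
      have hv : v x = fun j => evalAt ⟨_, hzx⟩ (diffFamily principalDomain.derivT
          principalDomain.coordX principalDomain.coordT g (some j)) := by
        funext j
        rcases j with n | _
        · exact (derivT_iterate_apply (F := fun z => gammaIntegral z.1 z.2) (fun z => (hg z).symm) n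
            ⟨_, hzx⟩).symm
        · rfl
      rw [hv]
      rfl
  rw [map_zero, MvPolynomial.comp_aeval_apply, ← hQw]
  congr 1
  congr 1
  funext j
  rcases j with n | _
  · exact derivT_iterate_apply (F := fun z => Complex.Gamma z.1) (fun z => rfl) n ⟨_, hz⟩
  · rfl

end IncompleteGamma

/-! ### Joint analyticity of the series `∑ (-x)^k / (k! (t + k))` -/

section ShiftedResolvent

open BoundedContinuousFunction

/-- The bounded sequence `1 / (k + 1)`. -/
def harmonicSeq : ℕ →ᵇ ℂ :=
  ofNormedAddCommGroupDiscrete (fun k => ((k : ℂ) + 1)⁻¹) 1 fun k => by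
    rw [norm_inv]
    have h : ‖(k : ℂ) + 1‖ = k + 1 := by
      rw [← Nat.cast_succ, Complex.norm_natCast, Nat.cast_succ]
    rw [h]
    exact inv_le_one_of_one_le₀ (by linarith [k.cast_nonneg (α := ℝ)])

/-- The left shift of bounded sequences. -/
def leftShift : (ℕ →ᵇ ℂ) →L[ℂ] (ℕ →ᵇ ℂ) :=
  LinearMap.mkContinuous
    { toFun := fun f => f.compContinuous ⟨Nat.succ, continuous_of_discreteTopology⟩
      map_add' := fun _ _ => rfl
      map_smul' := fun _ _ => rfl } 1 fun f => by
    rw [one_mul]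
    exact (norm_le (norm_nonneg f)).2 fun k => f.norm_coe_le_norm _

theorem smul_leftShift_pow_apply (c : ℂ) (n : ℕ) (f : ℕ →ᵇ ℂ) (j : ℕ) :
    ((c • leftShift) ^ n) f j = c ^ n * f (j + n) := by
  induction n generalizing f with
  | zero => exact (one_mul _).symm
  | succ n ih =>
    rw [pow_succ]
    change ((c • leftShift) ^ n) ((c • leftShift) f) j = _
    rw [ih, pow_succ, mul_assoc]
    rfl

/-- The bounded sequence `1 / (t + k)`, for `Re t > 0`. -/
def resolventSeq (t : ℂ) : ℕ →ᵇ ℂ :=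
  Ring.inverse (1 + (t - 1) • harmonicSeq) * harmonicSeq

theorem add_natCast_ne_zero {t : ℂ} (ht : 0 < t.re) (k : ℕ) : t + k ≠ 0 := by
  intro h
  have h1 := congrArg Complex.re h
  simp at h1
  linarith [k.cast_nonneg (α := ℝ)]

/-- The entries are `(t + k) / (k + 1)`, whose inverses are bounded by `1 + 1 / Re t`. So `1 / (t +
k)` arises by inversion in the Banach algebra of bounded sequences, which is analytic at units. -/
theorem isUnit_one_add_smul_harmonicSeq {t : ℂ} (ht : 0 < t.re) :
    IsUnit (1 + (t - 1) • harmonicSeq) := by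
  have hbound : ∀ k : ℕ, ‖((k : ℂ) + 1) * (t + k)⁻¹‖ ≤ 1 + t.re⁻¹ := by
    intro k
    have hk := k.cast_nonneg (α := ℝ)
    have h : ‖(k : ℂ) + 1‖ = k + 1 := by
      rw [← Nat.cast_succ, Complex.norm_natCast, Nat.cast_succ]
    have h1 : t.re + k ≤ ‖t + k‖ := by simpa using Complex.re_le_norm (t + k)
    rw [norm_mul, norm_inv, h, ← div_eq_mul_inv, div_le_iff₀ (by linarith)]
    calc (k : ℝ) + 1 ≤ (1 + t.re⁻¹) * (t.re + k) := by
          have h2 : t.re⁻¹ * t.re = 1 := inv_mul_cancel₀ ht.ne'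
          have h3 : 0 ≤ t.re⁻¹ * k := by positivity
          nlinarith
      _ ≤ _ := by gcongr
  refine IsUnit.of_mul_eq_one (ofNormedAddCommGroupDiscrete _ _ hbound) ?_
  ext k
  have h1 := add_natCast_ne_zero ht k
  have h2 : (k : ℂ) + 1 ≠ 0 := Nat.cast_add_one_ne_zero k
  change (1 + (t - 1) * ((k : ℂ) + 1)⁻¹) * (((k : ℂ) + 1) * (t + k)⁻¹) = 1
  field_simp
  ring

theorem resolventSeq_apply {t : ℂ} (ht : 0 < t.re) (k : ℕ) :
    resolventSeq t k = (t + k)⁻¹ := by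
  have h : (1 + (t - 1) • harmonicSeq) * resolventSeq t = harmonicSeq := by
    rw [resolventSeq, ← mul_assoc, Ring.mul_inverse_cancel _ (isUnit_one_add_smul_harmonicSeq ht),
      one_mul]
  have h1 := DFunLike.congr_fun h k
  change (1 + (t - 1) * ((k : ℂ) + 1)⁻¹) * resolventSeq t k = ((k : ℂ) + 1)⁻¹ at h1
  have h2 := add_natCast_ne_zero ht k
  have h3 : (k : ℂ) + 1 ≠ 0 := Nat.cast_add_one_ne_zero k
  field_simp at h1 ⊢
  linear_combination h1

theorem analyticAt_resolventSeq {t : ℂ} (ht : 0 < t.re) : AnalyticAt ℂ resolventSeq t := by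
  obtain ⟨u, hu⟩ := isUnit_one_add_smul_harmonicSeq ht
  have h1 : AnalyticAt ℂ (fun t : ℂ => 1 + (t - 1) • harmonicSeq) t :=
    analyticAt_const.add ((analyticAt_id.sub analyticAt_const).smul analyticAt_const)
  have h2 : AnalyticAt ℂ Ring.inverse (1 + (t - 1) • harmonicSeq) := by
    rw [← hu]
    exact analyticAt_inverse u
  exact (AnalyticAt.comp (f := fun t : ℂ => 1 + (t - 1) • harmonicSeq) h2 h1).mul
    analyticAt_const

/-- The sum `∑ (-x)^k / (k! (t + k))`. -/
def gammaSeries (t x : ℂ) : ℂ :=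
  NormedSpace.exp ((-x) • leftShift) (resolventSeq t) 0

theorem hasSum_gammaSeries {t : ℂ} (ht : 0 < t.re) (x : ℂ) :
    HasSum (fun k : ℕ => (k.factorial : ℂ)⁻¹ * (-x) ^ k * (t + k)⁻¹) (gammaSeries t x) := by
  have h := NormedSpace.exp_series_hasSum_exp' (𝕂 := ℂ) ((-x) • leftShift)
  have h1 := h.mapL (ContinuousLinearMap.apply ℂ (ℕ →ᵇ ℂ) (resolventSeq t))
  have h2 := h1.mapL (evalCLM ℂ (0 : ℕ))
  suffices heq : (fun k : ℕ => (k.factorial : ℂ)⁻¹ * (-x) ^ k * (t + k)⁻¹) = _ by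
    rw [heq]
    exact h2
  funext k
  change _ = (k.factorial : ℂ)⁻¹ * (((-x) • leftShift) ^ k) (resolventSeq t) 0
  rw [smul_leftShift_pow_apply, zero_add, resolventSeq_apply ht, mul_assoc]

/-- The exponential of `-x` times the left shift is analytic in `x`, the sequence `1 / (t + k)` is
analytic in `t`, and applying an operator to a vector is continuous bilinear; the two variables
separate. -/
theorem analyticAt_gammaSeries {z : ℂ × ℂ} (hz : 0 < z.1.re) :
    AnalyticAt ℂ (fun z : ℂ × ℂ => gammaSeries z.1 z.2) z := by
  have h1 : AnalyticAt ℂ (fun z : ℂ × ℂ => NormedSpace.exp ((-z.2) • leftShift)) z :=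
    AnalyticAt.comp (f := fun z : ℂ × ℂ => (-z.2) • leftShift)
      (NormedSpace.exp_analytic (𝕂 := ℂ) (𝔸 := (ℕ →ᵇ ℂ) →L[ℂ] (ℕ →ᵇ ℂ)) _) (analyticAt_snd.neg.smul analyticAt_const)
  have h2 : AnalyticAt ℂ (fun z : ℂ × ℂ => resolventSeq z.1) z :=
    (analyticAt_resolventSeq hz).comp analyticAt_fst
  have h3 := (ContinuousLinearMap.analyticAt_bilinear
    (ContinuousLinearMap.id ℂ ((ℕ →ᵇ ℂ) →L[ℂ] (ℕ →ᵇ ℂ))) _).comp (h1.prod h2)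
  exact ((evalCLM ℂ (0 : ℕ) : (ℕ →ᵇ ℂ) →L[ℂ] ℂ).analyticAt _).comp h3

end ShiftedResolvent

/-! ### Series expansion and holomorphy of the integral -/

namespace IncompleteGamma

open MeasureTheory Domain₂

theorem integral_cpow_mul_exp {t : ℂ} (ht : 0 < t.re) (x : ℂ) :
    ∫ u in (0 : ℝ)..1, (u : ℂ) ^ (t - 1) * Complex.exp (-((u : ℂ) * x)) = gammaSeries t x := by
  have hre : -1 < (t - 1).re := by simp; linarith
  have hint : IntervalIntegrable (fun u : ℝ => (u : ℂ) ^ (t - 1)) volume 0 1 :=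
    intervalIntegral.intervalIntegrable_cpow' hre
  let F : ℕ → ℝ → ℂ := fun k u => (u : ℂ) ^ (t - 1) * ((k.factorial : ℂ)⁻¹ * (-((u : ℂ) * x)) ^ k)
  -- For `0 < u ≤ 1` the `k`-th term of the exponential series is at most `‖x‖ ^ k / k!`, so
  -- termwise integration is dominated by an integrable multiple of `‖u ^ (t - 1)‖`.
  let bound : ℕ → ℝ → ℝ := fun k u => ‖(u : ℂ) ^ (t - 1)‖ * ((k.factorial : ℝ)⁻¹ * ‖x‖ ^ k)
  have hexp : ∀ y : ℝ, HasSum (fun k : ℕ => (k.factorial : ℝ)⁻¹ * y ^ k) (Real.exp y) := by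
    intro y
    have := NormedSpace.exp_series_hasSum_exp' (𝕂 := ℝ) y
    rwa [← Real.exp_eq_exp_ℝ] at this
  have hsum := intervalIntegral.hasSum_integral_of_dominated_convergence (μ := volume)
    (a := 0) (b := 1) (F := F) (f := fun u => (u : ℂ) ^ (t - 1) * Complex.exp (-((u : ℂ) * x)))
    bound ?_ ?_ ?_ ?_ ?_
  · refine hsum.unique ?_
    suffices heq : (fun k => ∫ u in (0 : ℝ)..1, F k u) = _ by
      rw [heq]
      exact hasSum_gammaSeries ht x
    funext k
    have hcongr : ∫ u in (0 : ℝ)..1, F k u = ∫ u in (0 : ℝ)..1,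
        (u : ℂ) ^ (t - 1 + k) * ((k.factorial : ℂ)⁻¹ * (-x) ^ k) := by
      refine intervalIntegral.integral_congr_ae (Filter.Eventually.of_forall fun u hu => ?_)
      rw [Set.uIoc_of_le zero_le_one] at hu
      have hu0 : (u : ℂ) ≠ 0 := by exact_mod_cast hu.1.ne'
      simp only [F]
      rw [Complex.cpow_add _ _ hu0, Complex.cpow_natCast, neg_mul_eq_mul_neg, mul_pow]
      ring
    have hk := k.cast_nonneg (α := ℝ)
    have htk := add_natCast_ne_zero ht k
    rw [hcongr, intervalIntegral.integral_mul_const, integral_cpow (Or.inl (by simp; linarith))]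
    have h0 : t - 1 + k + 1 = t + k := by ring
    rw [h0]
    simp only [Complex.ofReal_one, Complex.one_cpow, Complex.ofReal_zero,
      Complex.zero_cpow htk]
    ring
  · intro k
    have hc : Continuous fun u : ℝ => (k.factorial : ℂ)⁻¹ * (-((u : ℂ) * x)) ^ k := by fun_prop
    exact hint.def'.aestronglyMeasurable.mul hc.aestronglyMeasurable
  · refine fun k => Filter.Eventually.of_forall fun u hu => ?_
    rw [Set.uIoc_of_le zero_le_one] at hu
    simp only [F, bound, norm_mul, norm_pow, norm_neg, norm_inv, Complex.norm_natCast,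
      Complex.norm_real, Real.norm_eq_abs, abs_of_pos hu.1]
    have hux : u * ‖x‖ ≤ ‖x‖ := mul_le_of_le_one_left (norm_nonneg x) hu.2
    have hu0 : 0 ≤ u * ‖x‖ := mul_nonneg hu.1.le (norm_nonneg x)
    gcongr
  · exact Filter.Eventually.of_forall fun u _ => ((hexp ‖x‖).mul_left _).summable
  · simp only [bound, fun u : ℝ => ((hexp ‖x‖).mul_left ‖(u : ℂ) ^ (t - 1)‖).tsum_eq]
    exact hint.norm.mul_const _
  · refine Filter.Eventually.of_forall fun u _ => HasSum.mul_left _ ?_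
    have := NormedSpace.exp_series_hasSum_exp' (𝕂 := ℂ) (-((u : ℂ) * x))
    rwa [← Complex.exp_eq_exp_ℂ] at this

theorem gammaIntegral_eq_cpow_mul {t x : ℂ} (ht : 0 < t.re) (hx : x ≠ 0) :
    gammaIntegral t x = x ^ t * gammaSeries t x := by
  rw [← integral_cpow_mul_exp ht, gammaIntegral, ← intervalIntegral.integral_const_mul]
  refine intervalIntegral.integral_congr_ae (Filter.Eventually.of_forall fun u hu => ?_)
  rw [Set.uIoc_of_le zero_le_one] at hu
  have hu0 : (u : ℂ) ≠ 0 := by exact_mod_cast hu.1.ne'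
  have hxt : x ^ t = x ^ (t - 1) * x := by
    rw [Complex.cpow_sub _ _ hx, Complex.cpow_one, div_mul_cancel₀ _ hx]
  -- Since `u > 0`, `log (u x) = log u + log x` with principal values, so no branch correction
  -- appears.
  have hux : ((u : ℂ) * x) ^ (t - 1) = (u : ℂ) ^ (t - 1) * x ^ (t - 1) := by
    rw [Complex.cpow_def_of_ne_zero (mul_ne_zero hu0 hx), Complex.cpow_def_of_ne_zero hu0,
      Complex.cpow_def_of_ne_zero hx, Complex.log_ofReal_mul hu.1 hx, ← Complex.exp_add,
      Complex.ofReal_log hu.1.le]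
    ring_nf
  rw [hux, hxt]
  ring

theorem analyticOnNhd_gammaIntegral :
    AnalyticOnNhd ℂ (fun z : ℂ × ℂ => gammaIntegral z.1 z.2) principalDomain.carrier := by
  intro z hz
  have h : AnalyticAt ℂ (fun z : ℂ × ℂ => z.2 ^ z.1 * gammaSeries z.1 z.2) z :=
    (analyticAt_snd.cpow analyticAt_fst hz.2).mul (analyticAt_gammaSeries hz.1)
  refine h.congr ?_
  filter_upwards [principalDomain.isOpen.mem_nhds hz] with w hw
  exact (gammaIntegral_eq_cpow_mul hw.1 (Complex.slitPlane_ne_zero hw.2)).symm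

end IncompleteGamma

/-! ### Convergence of `γ(t, x)` and its derivatives to `Γ(t)` -/

namespace IncompleteGamma

open MeasureTheory Filter Domain₂ Set

theorem gammaIntegral_ofReal {t : ℂ} {X : ℝ} :
    gammaIntegral t X = Complex.partialGamma t X := by
  have h := intervalIntegral.smul_integral_comp_mul_right (a := 0) (b := 1)
    (fun s : ℝ => ((Real.exp (-s) : ℝ) : ℂ) * (s : ℂ) ^ (t - 1)) X
  rw [zero_mul, one_mul] at h
  rw [Complex.partialGamma, ← h, gammaIntegral, ← intervalIntegral.integral_smul]
  refine intervalIntegral.integral_congr fun u _ => ?_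
  simp only [Complex.real_smul]
  push_cast
  ring

/-- On the tail `s ≥ 1`, so `s ^ (Re t - 1) ≤ s ^ (b - 1)`; the bound is uniform in `0 < Re t ≤ b`.
-/
theorem norm_Gamma_sub_gammaIntegral_le {t : ℂ} (ht : 0 < t.re) {b : ℝ} (htb : t.re ≤ b)
    {X : ℝ} (hX : 1 ≤ X) :
    ‖Complex.Gamma t - gammaIntegral t X‖ ≤ ∫ s in Ioi X, Real.exp (-s) * s ^ (b - 1) := by
  have hX0 : 0 < X := by linarith
  have hsub : Ioi X ⊆ Ioi (0 : ℝ) := Ioi_subset_Ioi hX0.le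
  have hint := Complex.GammaIntegral_convergent ht
  have hb := Real.GammaIntegral_convergent (ht.trans_le htb)
  have h := intervalIntegral.integral_interval_add_Ioi hint (hint.mono_set hsub)
  rw [gammaIntegral_ofReal, Complex.Gamma_eq_integral ht, Complex.GammaIntegral, ← h,
    Complex.partialGamma, add_sub_cancel_left]
  refine norm_integral_le_of_norm_le (hb.mono_set hsub) ?_
  refine (ae_restrict_mem measurableSet_Ioi).mono fun s hs => ?_
  have hs1 : 1 ≤ s := hX.trans (le_of_lt hs)
  rw [norm_mul, Complex.norm_real, Real.norm_of_nonneg (Real.exp_pos _).le,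
    Complex.norm_cpow_eq_rpow_re_of_pos (by linarith)]
  gcongr
  simpa using htb

theorem tendsto_integral_tail (b : ℝ) (hb : 0 < b) :
    Tendsto (fun X : ℝ => ∫ s in Ioi X, Real.exp (-s) * s ^ (b - 1)) atTop (𝓝 0) := by
  have hint := Real.GammaIntegral_convergent hb
  have h := (tendsto_const_nhds (x := ∫ s in Ioi (0 : ℝ), Real.exp (-s) * s ^ (b - 1))).sub
    (intervalIntegral_tendsto_integral_Ioi 0 hint tendsto_id)
  rw [sub_self] at h
  refine h.congr' ?_
  filter_upwards [eventually_gt_atTop 0] with X hX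
  rw [← intervalIntegral.integral_interval_add_Ioi hint (hint.mono_set (Ioi_subset_Ioi hX.le))]
  simp

theorem tendstoLocallyUniformlyOn_gammaIntegral :
    TendstoLocallyUniformlyOn (fun (X : ℝ) (t : ℂ) => gammaIntegral t X) Complex.Gamma atTop
      {t : ℂ | 0 < t.re} := by
  rw [Metric.tendstoLocallyUniformlyOn_iff]
  intro ε hε t₀ ht₀
  have ht₀' : 0 < t₀.re := ht₀
  have hnhds : {t : ℂ | t.re < t₀.re + 1} ∈ 𝓝 t₀ :=
    (isOpen_lt Complex.continuous_re continuous_const).mem_nhds (by simp)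
  refine ⟨_, inter_mem self_mem_nhdsWithin (mem_nhdsWithin_of_mem_nhds hnhds), ?_⟩
  filter_upwards [eventually_ge_atTop 1,
    (tendsto_integral_tail (t₀.re + 1) (by linarith)).eventually_lt_const hε] with X hX hlt
  rintro t ⟨ht, htb⟩
  rw [dist_eq_norm]
  exact (norm_Gamma_sub_gammaIntegral_le ht (le_of_lt htb) hX).trans_lt hlt

theorem analyticOnNhd_gammaIntegral_left {X : ℝ} (hX : 0 < X) :
    AnalyticOnNhd ℂ (fun t => gammaIntegral t X) {t : ℂ | 0 < t.re} := fun t ht =>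
  (analyticOnNhd_gammaIntegral (t, X)
    (mem_principalDomain.2 ⟨ht, Complex.ofReal_mem_slitPlane.2 hX⟩)).comp
    (f := fun t => (t, (X : ℂ))) (analyticAt_id.prod analyticAt_const)

/-- Weierstrass: locally uniform limits of holomorphic functions may be differentiated. Holomorphy
in `t` is needed only for large `X`. -/
theorem tendstoLocallyUniformlyOn_iteratedDeriv (n : ℕ) :
    TendstoLocallyUniformlyOn
      (fun (X : ℝ) => iteratedDeriv n fun t => gammaIntegral t X)
      (iteratedDeriv n Complex.Gamma) atTop {t : ℂ | 0 < t.re} := by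
  induction n with
  | zero => simpa using tendstoLocallyUniformlyOn_gammaIntegral
  | succ n ih =>
    simp only [iteratedDeriv_succ]
    refine ih.deriv ?_ (isOpen_lt continuous_const Complex.continuous_re)
    filter_upwards [eventually_gt_atTop 0] with X hX
    rw [iteratedDeriv_eq_iterate]
    exact ((analyticOnNhd_gammaIntegral_left hX).iterated_deriv n).differentiableOn

theorem tendsto_iteratedDeriv_gammaIntegral (n : ℕ) {t : ℂ} (ht : 0 < t.re) :
    Tendsto (fun x : ℝ => iteratedDeriv n (fun t => gammaIntegral t x) t) atTop
      (𝓝 (iteratedDeriv n Complex.Gamma t)) :=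
  (tendstoLocallyUniformlyOn_iteratedDeriv n).tendsto_at ht

end IncompleteGamma

end

theorem theorem1p1 :
    AnalyticOnNhd ℂ (fun z : ℂ × ℂ => IncompleteGamma.gammaIntegral z.1 z.2)
      IncompleteGamma.principalDomain.carrier ∧
    ∀ (D : Domain₂) (γ : D.Mero), IncompleteGamma.IsBranch D γ →
      IsDiffTranscendental D.rationalFunctions D.meroDerivT γ :=
  ⟨IncompleteGamma.analyticOnNhd_gammaIntegral, fun _ _ hγ =>
    hγ.isDiffTranscendental (IncompleteGamma.isIndependent_of_tendsto
      fun n _ ht => IncompleteGamma.tendsto_iteratedDeriv_gammaIntegral n ht)⟩
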